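/- Let $k$ be a field, $V$ a finite-dimensional $k$-vector space, $F = T(V) = \bigoplus_{n\ge 0} F_n$ its tensor algebra with $F_n = V^{\otimes n}$, let $R \subset F_1 \oplus F_2 = V \oplus (V\otimes V)$ be a subspace with $R \cap V = 0$, let $I$ be the two-sided ideal of $F$ generated by $R$, and let $A \cong F/I$ (an almost quadratic algebra). Let $A^0$ be the graded algebra obtained as the quotient of $F$ by the two-sided ideal generated by the projection of $R$ on $F_2 = V\otimes V$. Let $\operatorname{gr} A = \bigoplus_{n\ge 0} A_{\le n}/A_{\le n-1}$ be the associated graded algebra of $A$ with respect to the filtration by degree, where $A_{\le n}$ is the image of $F_0\oplus\dots\oplus F_n$ in $A$ and $A_{\le -1} = 0$. Suppose that $A$ is PBW, that is, for some bases $v_1,\dots,v_n$ of $V$ and $r_1,\dots,r_m$ of $R$, the set $\{r_1,\dots,r_m\}$ is a Gröbner basis of $I$ with respect to the degree-lexicographical order on the words in $v_1 > \dots > v_n$ (the leading word of every nonzero element of $I$ contains the leading word of some $r_i$ as a subword). Then $A$ is Koszul in the sense of Priddy: $A^0$ and $\operatorname{gr} A$ are isomorphic as graded algebras, and both are Koszul.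 Here a graded algebra $B = \bigoplus_{n \ge 0} B_n$ with finite-dimensional components is called Koszul if $B_0 = k$, $B$ is generated by $B_1$, and $\operatorname{Tor}^B_i(k,k)$ is concentrated in internal degree $i$ for every $i\ge 0$. -/

import Mathlib

open scoped DirectSum TensorProduct

noncomputable section

namespace AlmostQuadratic

/-! ### The bar complex and homogeneous Koszul algebras -/

section Bar

variable {k B : Type*} [Field k] [Ring B] [Algebra k B]

/-- The `j`-th face of a word `(a₀, …, aₙ)`: the neighbours `aⱼ, aⱼ₊₁` are replaced by their
product. -/
def face {n : ℕ} (j : Fin n) (a : Fin (n + 1) → B) : Fin n → B :=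
  Fin.contractNth j.castSucc (· * ·) a

variable (k) in
lemma face_update {n : ℕ} [DecidableEq (Fin (n + 1))] (j : Fin n)
    (a : Fin (n + 1) → B) (p : Fin (n + 1)) :
    ∃ (q : Fin n) (φ : B →ₗ[k] B), ∀ x,
      face j (Function.update a p x) = Function.update (face j a) q (φ x) := by
  rcases lt_trichotomy (p : ℕ) j with h | h | h
  · refine ⟨⟨p, by omega⟩, LinearMap.id, fun x => funext fun i => ?_⟩
    simp only [face, Fin.contractNth, Function.update_apply, Fin.ext_iff, Fin.val_castSucc,
      Fin.val_succ, LinearMap.id_apply]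
    split_ifs <;> first | rfl | omega
  · refine ⟨j, LinearMap.mulRight k (a j.succ), fun x => funext fun i => ?_⟩
    simp only [face, Fin.contractNth, Function.update_apply, Fin.ext_iff, Fin.val_castSucc,
      Fin.val_succ, LinearMap.mulRight_apply]
    split_ifs <;> first | rfl | omega | (obtain rfl : i = j := Fin.ext (by omega); rfl)
  · by_cases h' : (p : ℕ) = j + 1
    · refine ⟨j, LinearMap.mulLeft k (a j.castSucc), fun x => funext fun i => ?_⟩
      simp only [face, Fin.contractNth, Function.update_apply, Fin.ext_iff, Fin.val_castSucc,
        Fin.val_succ, LinearMap.mulLeft_apply]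
      split_ifs <;> first | rfl | omega | (obtain rfl : i = j := Fin.ext (by omega); rfl)
    · refine ⟨⟨p - 1, by omega⟩, LinearMap.id, fun x => funext fun i => ?_⟩
      simp only [face, Fin.contractNth, Function.update_apply, Fin.ext_iff, Fin.val_castSucc,
        Fin.val_succ, LinearMap.id_apply]
      split_ifs <;> first | rfl | omega

/-- The multilinear map `(a₀, …, aₙ) ↦ a₀ ⊗ ⋯ ⊗ aⱼaⱼ₊₁ ⊗ ⋯ ⊗ aₙ`. -/
def faceMultilinear (k B : Type*) [Field k] [Ring B] [Algebra k B] {n : ℕ} (j : Fin n) :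
    MultilinearMap k (fun _ : Fin (n + 1) => B) (⨂[k] _ : Fin n, B) where
  toFun a := PiTensorProduct.tprod k (face j a)
  map_update_add' a p x y := by
    obtain ⟨q, φ, h⟩ := face_update k j a p
    simp only [h, map_add, MultilinearMap.map_update_add]
  map_update_smul' a p c x := by
    obtain ⟨q, φ, h⟩ := face_update k j a p
    simp only [h, map_smul, MultilinearMap.map_update_smul]

/-- The bar differential
`d (a₀ ⊗ ⋯ ⊗ aₙ) = ∑ⱼ (-1)ʲ a₀ ⊗ ⋯ ⊗ aⱼaⱼ₊₁ ⊗ ⋯ ⊗ aₙ`, where `0 ≤ j < n`. -/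
def barD (k B : Type*) [Field k] [Ring B] [Algebra k B] (n : ℕ) :
    (⨂[k] _ : Fin (n + 1), B) →ₗ[k] (⨂[k] _ : Fin n, B) :=
  ∑ j : Fin n, (-1 : k) ^ (j : ℕ) • PiTensorProduct.lift (faceMultilinear k B j)

/-- The component of homological degree `n` and internal degree `j` of the reduced bar complex
`(B₊)^{⊗ n}`, `B₊ = ⨁_{d > 0} 𝓑 d`, seen inside `B^{⊗ n}`: it is spanned by the tensors
`a₁ ⊗ ⋯ ⊗ aₙ` of homogeneous elements of positive degrees with sum `j`. -/
def bar (𝓑 : ℕ → Submodule k B) (n j : ℕ) : Submodule k (⨂[k] _ : Fin n, B) :=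
  Submodule.span k {t | ∃ (d : Fin n → ℕ) (a : Fin n → B),
    (∀ i, 0 < d i) ∧ ∑ i, d i = j ∧ (∀ i, a i ∈ 𝓑 (d i)) ∧ t = PiTensorProduct.tprod k a}

/-- The cycles of the reduced bar complex, of homological degree `n` and internal degree `j`. -/
def barCycles (𝓑 : ℕ → Submodule k B) : (n j : ℕ) → Submodule k (⨂[k] _ : Fin n, B)
  | 0, j => bar 𝓑 0 j
  | n + 1, j => bar 𝓑 (n + 1) j ⊓ LinearMap.ker (barD k B n)

/-- The boundaries of the reduced bar complex, of homological degree `n` and internal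
degree `j`. -/
def barBoundaries (𝓑 : ℕ → Submodule k B) (n j : ℕ) : Submodule k (⨂[k] _ : Fin n, B) :=
  (bar 𝓑 (n + 1) j).map (barD k B n)

/-- The component of internal degree `j` of `H_n B = Tor_n^B(k, k)` for a connected graded
algebra `B`, computed by the reduced bar complex. -/
abbrev TorComponent (𝓑 : ℕ → Submodule k B) (n j : ℕ) : Type _ :=
  barCycles 𝓑 n j ⧸ (barBoundaries 𝓑 n j).submoduleOf (barCycles 𝓑 n j)

/-- A standard algebra: a connected `ℕ`-graded algebra with finite-dimensional components which
is generated by its component of degree one. -/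
structure IsStandard (𝓑 : ℕ → Submodule k B) : Prop where
  one_mem : (1 : B) ∈ 𝓑 0
  mul_mem : ∀ (i j : ℕ) (x y : B), x ∈ 𝓑 i → y ∈ 𝓑 j → x * y ∈ 𝓑 (i + j)
  isInternal : DirectSum.IsInternal 𝓑
  finite : ∀ i, FiniteDimensional k (𝓑 i)
  nontrivial : Nontrivial B
  connected : 𝓑 0 = Submodule.span k {1}
  generated : Algebra.adjoin k (𝓑 1 : Set B) = ⊤

/-- A (homogeneous) Koszul algebra: a standard algebra `B` such that `H_n B = Tor_n^B(k, k)` is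
concentrated in internal degree `n`, for every `n`. -/
structure IsKoszul (𝓑 : ℕ → Submodule k B) : Prop extends IsStandard 𝓑 where
  tor_concentrated : ∀ n j : ℕ, j ≠ n → Subsingleton (TorComponent 𝓑 n j)

end Bar

/-! ### The associated graded algebra of the degree filtration -/

section Gr

variable {k A : Type*} [Field k] [Ring A] [Algebra k A]

/-- The filtration by degree defined by a space `W` of generators: the `n`-th term is spanned by
the products of at most `n` elements of `W`. -/
def filt (W : Submodule k A) (n : ℕ) : Submodule k A := (1 ⊔ W) ^ n

/-- The sum of the terms of the filtration of index less than `n`; it is `0` for `n = 0` and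
`filt W (n - 1)` otherwise. -/
def filtLT (W : Submodule k A) (n : ℕ) : Submodule k A := ⨆ (m : ℕ) (_ : m < n), filt W m

variable {W : Submodule k A}

lemma one_mem_filt : (1 : A) ∈ filt W 0 := by
  rw [filt, pow_zero]; exact Submodule.one_le.mp le_rfl

lemma mul_mem_filt {i j : ℕ} {x y : A} (hx : x ∈ filt W i) (hy : y ∈ filt W j) :
    x * y ∈ filt W (i + j) := by
  rw [filt, pow_add]; exact Submodule.mul_mem_mul hx hy

lemma filt_le_filtLT {m n : ℕ} (h : m < n) : filt W m ≤ filtLT W n :=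
  le_iSup₂_of_le m h le_rfl

lemma mul_mem_filtLT_left {i j : ℕ} {x y : A} (hx : x ∈ filtLT W i) (hy : y ∈ filt W j) :
    x * y ∈ filtLT W (i + j) := by
  have : filtLT W i ≤ (filtLT W (i + j)).comap (LinearMap.mulRight k y) :=
    iSup₂_le fun m hm z hz => filt_le_filtLT (by omega) (mul_mem_filt hz hy)
  exact this hx

lemma mul_mem_filtLT_right {i j : ℕ} {x y : A} (hx : x ∈ filt W i) (hy : y ∈ filtLT W j) :
    x * y ∈ filtLT W (i + j) := by
  have : filtLT W j ≤ (filtLT W (i + j)).comap (LinearMap.mulLeft k x) :=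
    iSup₂_le fun m hm z hz => filt_le_filtLT (by omega) (mul_mem_filt hx hz)
  exact this hy

variable (W) in
/-- The `n`-th component `F_n A / F_{n-1} A` of the associated graded algebra. -/
def GrComp (n : ℕ) : Type _ := filt W n ⧸ (filtLT W n).submoduleOf (filt W n)

instance (n : ℕ) : AddCommGroup (GrComp W n) :=
  inferInstanceAs (AddCommGroup (filt W n ⧸ (filtLT W n).submoduleOf (filt W n)))

instance (n : ℕ) : Module k (GrComp W n) :=
  inferInstanceAs (Module k (filt W n ⧸ (filtLT W n).submoduleOf (filt W n)))

variable (W) in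
/-- The class in `F_n A / F_{n-1} A` of an element of `F_n A`. -/
def symb (n : ℕ) : filt W n →ₗ[k] GrComp W n := ((filtLT W n).submoduleOf (filt W n)).mkQ

lemma symb_surjective (n : ℕ) : Function.Surjective (symb W n) := Submodule.mkQ_surjective _

lemma symb_eq_zero_iff {n : ℕ} (x : filt W n) : symb W n x = 0 ↔ (x : A) ∈ filtLT W n :=
  Submodule.Quotient.mk_eq_zero _

/-- Multiplication `F_i A → F_j A → F_{i+j} A`. -/
def filtMul (i j : ℕ) : filt W i →ₗ[k] filt W j →ₗ[k] filt W (i + j) :=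
  LinearMap.mk₂ k (fun x y => ⟨x * y, mul_mem_filt x.2 y.2⟩)
    (fun _ _ _ => Subtype.ext (add_mul _ _ _)) (fun _ _ _ => Subtype.ext (smul_mul_assoc _ _ _))
    (fun _ _ _ => Subtype.ext (mul_add _ _ _)) (fun _ _ _ => Subtype.ext (mul_smul_comm _ _ _))

/-- The product of the associated graded algebra, induced by the one of `A`. -/
def grMul (i j : ℕ) : GrComp W i →ₗ[k] GrComp W j →ₗ[k] GrComp W (i + j) :=
  Submodule.liftQ _
    (LinearMap.flip (Submodule.liftQ _
      (LinearMap.flip ((filtMul (W := W) i j).compr₂ (symb W (i + j))))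
      (fun y hy => LinearMap.ext fun x =>
        (symb_eq_zero_iff _).2 (mul_mem_filtLT_right x.2 hy))))
    (fun x hx => LinearMap.ext fun y => by
      obtain ⟨y, rfl⟩ := symb_surjective j y
      exact (symb_eq_zero_iff _).2 (mul_mem_filtLT_left hx y.2))

lemma grMul_symb {i j : ℕ} (x : filt W i) (y : filt W j) :
    grMul i j (symb W i x) (symb W j y) =
      symb W (i + j) ⟨x * y, mul_mem_filt x.2 y.2⟩ := rfl

lemma mk_symb_eq {i j : ℕ} (h : i = j) (x : filt W i) (y : filt W j) (hxy : (x : A) = y) :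
    GradedMonoid.mk (A := GrComp W) i (symb W i x) = GradedMonoid.mk j (symb W j y) := by
  subst h
  rw [Subtype.ext hxy]

/-- The unit of the associated graded algebra. -/
def grOne : GrComp W 0 := symb W 0 ⟨1, one_mem_filt⟩

instance : GradedMonoid.GMul (GrComp W) where mul x y := grMul _ _ x y

instance : GradedMonoid.GOne (GrComp W) where one := grOne

instance : DirectSum.GRing (GrComp W) where
  mul x y := grMul _ _ x y
  one := grOne
  mul_zero _ := map_zero _
  zero_mul _ := by simp
  mul_add _ _ _ := map_add _ _ _
  add_mul _ _ _ := by simp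
  one_mul := by
    rintro ⟨i, x⟩
    obtain ⟨x, rfl⟩ := symb_surjective i x
    exact mk_symb_eq (zero_add i) _ _ (one_mul _)
  mul_one := by
    rintro ⟨i, x⟩
    obtain ⟨x, rfl⟩ := symb_surjective i x
    exact mk_symb_eq (add_zero i) _ _ (mul_one _)
  mul_assoc := by
    rintro ⟨i, x⟩ ⟨j, y⟩ ⟨l, z⟩
    obtain ⟨x, rfl⟩ := symb_surjective i x
    obtain ⟨y, rfl⟩ := symb_surjective j y
    obtain ⟨z, rfl⟩ := symb_surjective l z
    exact mk_symb_eq (add_assoc i j l) _ _ (mul_assoc _ _ _)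
  natCast m := m • grOne
  natCast_zero := zero_smul _ _
  natCast_succ m := succ_nsmul _ _
  intCast m := m • grOne
  intCast_ofNat m := natCast_zsmul _ _
  intCast_negSucc_ofNat m := negSucc_zsmul _ _

instance : DirectSum.GAlgebra k (GrComp W) where
  toFun := (LinearMap.toSpanSingleton k (GrComp W 0) grOne).toAddMonoidHom
  map_one := one_smul k (grOne : GrComp W 0)
  map_mul r s := by
    refine mk_symb_eq (zero_add 0).symm ((r * s) • ⟨1, one_mem_filt⟩)
      ⟨(r • (1 : A)) * (s • (1 : A)), mul_mem_filt (Submodule.smul_mem _ _ one_mem_filt)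
        (Submodule.smul_mem _ _ one_mem_filt)⟩ ?_
    simp [mul_smul, smul_comm r s]
  commutes := by
    rintro r ⟨i, x⟩
    obtain ⟨x, rfl⟩ := symb_surjective i x
    refine mk_symb_eq (add_comm 0 i)
      ⟨(r • (1 : A)) * x, mul_mem_filt (Submodule.smul_mem _ _ one_mem_filt) x.2⟩
      ⟨x * (r • (1 : A)), mul_mem_filt x.2 (Submodule.smul_mem _ _ one_mem_filt)⟩ ?_
    simp
  smul_def := by
    rintro r ⟨i, x⟩
    obtain ⟨x, rfl⟩ := symb_surjective i x
    refine mk_symb_eq (zero_add i).symm (r • x)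
      ⟨(r • (1 : A)) * x, mul_mem_filt (Submodule.smul_mem _ _ one_mem_filt) x.2⟩ ?_
    simp

variable (W) in
/-- The associated graded algebra `gr A = ⨁ₙ F_n A / F_{n-1} A` of the filtration of `A` by
degree with respect to the space of generators `W`. -/
abbrev Gr : Type _ := ⨁ n, GrComp W n

variable (W) in
/-- The grading of `gr A`. -/
def grGrading (n : ℕ) : Submodule k (Gr W) :=
  LinearMap.range (DirectSum.lof k ℕ (GrComp W) n)

end Gr

/-! ### Almost quadratic algebras -/

section Presentation

variable {k V A : Type*} [Field k] [AddCommGroup V] [Module k V] [Ring A] [Algebra k A]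

variable (k V) in
/-- The component `F_n = V^{⊗ n}` of the tensor algebra `F = T(V)`. -/
abbrev tensorGrading (n : ℕ) : Submodule k (TensorAlgebra k V) :=
  LinearMap.range (TensorAlgebra.ι k : V →ₗ[k] TensorAlgebra k V) ^ n

/-- `π : T(V) → A` presents `A` as an almost quadratic algebra with the space of relations `R`:
`A = T(V) / (R)` with `R ⊆ V ⊕ V ⊗ V`. Generation by `V` is minimal in the sense that no relation
is linear, `R ∩ V = 0`. -/
structure IsAlmostQuadratic (π : TensorAlgebra k V →ₐ[k] A)
    (R : Submodule k (TensorAlgebra k V)) : Prop where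
  surjective : Function.Surjective π
  ker_eq : TwoSidedIdeal.ker π = TwoSidedIdeal.span (R : Set (TensorAlgebra k V))
  le : R ≤ tensorGrading k V 1 ⊔ tensorGrading k V 2
  inf_eq_bot : R ⊓ tensorGrading k V 1 = ⊥

/-- The quadratic parts of the relations: the projection of `R` on `V ⊗ V`. -/
def quadraticPart (R : Submodule k (TensorAlgebra k V)) : Submodule k (TensorAlgebra k V) :=
  R.map (GradedAlgebra.proj (tensorGrading k V) 2)

/-- The ideal of relations of `A⁰`. -/
def quadraticCon (R : Submodule k (TensorAlgebra k V)) : RingCon (TensorAlgebra k V) :=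
  (TwoSidedIdeal.span (quadraticPart R : Set (TensorAlgebra k V))).ringCon

/-- The quadratic algebra `A⁰`: the quotient of `T(V)` by the two-sided ideal generated by the
projection of `R` on `V ⊗ V`. -/
abbrev QuadraticAlg (R : Submodule k (TensorAlgebra k V)) : Type _ := (quadraticCon R).Quotient

/-- The grading of `A⁰` induced by the one of `T(V)`. -/
def quadraticGrading (R : Submodule k (TensorAlgebra k V)) (n : ℕ) :
    Submodule k (QuadraticAlg R) :=
  (tensorGrading k V n).map ((quadraticCon R).mkₐ k).toLinearMap

/-- The image of `V` in `A`. -/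
def generators (π : TensorAlgebra k V →ₐ[k] A) : Submodule k A :=
  LinearMap.range (π.toLinearMap ∘ₗ TensorAlgebra.ι k)

/-- Koszulity in Priddy's sense: `A⁰` and `gr A` are isomorphic as graded algebras and both of
them are Koszul. -/
structure IsPriddyKoszul (π : TensorAlgebra k V →ₐ[k] A)
    (R : Submodule k (TensorAlgebra k V)) : Prop where
  iso : ∃ e : QuadraticAlg R ≃ₐ[k] Gr (generators π),
    ∀ n, (quadraticGrading R n).map e.toLinearMap = grGrading (generators π) n
  koszul_quadratic : IsKoszul (quadraticGrading R)
  koszul_gr : IsKoszul (grGrading (generators π))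

/-! ### Gröbner bases and PBW algebras -/

/-- The strict degree-lexicographical order on words in the letters `v₀ > v₁ > ⋯ > vₙ₋₁`. -/
def DegLexLT {n : ℕ} (u w : FreeMonoid (Fin n)) : Prop :=
  List.Shortlex (fun i j : Fin n => j < i) u.toList w.toList

/-- `w` is the leading monomial of `f ∈ T(V)`, expanded in the words in the basis `b` of `V`. -/
def IsLeadingWord {n : ℕ} (b : Module.Basis (Fin n) k V) (f : TensorAlgebra k V)
    (w : FreeMonoid (Fin n)) : Prop :=
  b.tensorAlgebra.repr f w ≠ 0 ∧
    ∀ u, b.tensorAlgebra.repr f u ≠ 0 → u ≠ w → DegLexLT u w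

/-- `G` is a Gröbner basis of `I`: `G ⊆ I`, and the leading monomial of each nonzero element of `I`
contains the leading monomial of an element of `G` as a subword. -/
def IsGroebnerBasis {n : ℕ} (b : Module.Basis (Fin n) k V) (G : Set (TensorAlgebra k V))
    (I : TwoSidedIdeal (TensorAlgebra k V)) : Prop :=
  (∀ g ∈ G, g ∈ I) ∧ ∀ f ∈ I, ∀ w, IsLeadingWord b f w →
    ∃ g ∈ G, ∃ u, IsLeadingWord b g u ∧ u.toList <:+: w.toList

/-- The PBW property: for some bases of `V` and `R`, the basis of `R` is a Gröbner basis of the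
ideal of relations. -/
def IsPBW (R : Submodule k (TensorAlgebra k V)) : Prop :=
  ∃ (n : ℕ) (b : Module.Basis (Fin n) k V) (m : ℕ) (r : Module.Basis (Fin m) k R),
    IsGroebnerBasis b (Set.range fun i => (r i : TensorAlgebra k V))
      (TwoSidedIdeal.span (R : Set (TensorAlgebra k V)))

end Presentation

end AlmostQuadratic

end

/-!
By the Gröbner property a combination of normal words which vanishes in `gr A` is zero, while the
quadratic parts of the relations, which vanish in both `A⁰` and `gr A`, rewrite every word as a
combination of normal words. Hence the normal words form a basis of `A⁰` and of `gr A`, and the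
canonical surjection `A⁰ → gr A` is an isomorphism.

For Koszulity, filter the reduced bar complex of an algebra with such a basis by the concatenations
of its words. Up to terms with a smaller concatenation, the differential only sees how a fixed word
is cut into normal pieces. If the word has more letters than pieces, a contracting homotopy is
given by cutting the first letter off the first longer piece where the letters before it form
leading pairs with their successors, and by zero elsewhere. Induction along the
degree-lexicographical order then shows that the homology is concentrated on the diagonal.
-/

noncomputable section

namespace AlmostQuadratic

open TensorAlgebra (ι)

/-! ### Left recursion on the tensor algebra -/

section LeftRecursion

variable {k M N : Type*} [CommSemiring k] [AddCommMonoid M] [Module k M] [AddCommMonoid N]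
  [Module k N]

theorem tensorAlgebra_induction_left {C : TensorAlgebra k M → Prop} (one : C 1)
    (smul : ∀ (r : k) (t), C t → C (r • t)) (add : ∀ s t, C s → C t → C (s + t))
    (ι_mul : ∀ x t, C t → C (ι k x * t)) (t : TensorAlgebra k M) : C t := by
  suffices h : ∀ s, C s → C (t * s) by simpa using h 1 one
  induction t using TensorAlgebra.induction with
  | algebraMap r => exact fun s hs => by simpa only [Algebra.smul_def] using smul r s hs
  | ι x => exact ι_mul x
  | mul a b ha hb => exact fun s hs => by simpa only [mul_assoc] using ha _ (hb s hs)
  | add a b ha hb => exact fun s hs => by simpa only [add_mul] using add _ _ (ha s hs) (hb s hs)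

theorem tensorAlgebra_linearMap_ext {f g : TensorAlgebra k M →ₗ[k] N} (one : f 1 = g 1)
    (ι_mul : ∀ x t, f t = g t → f (ι k x * t) = g (ι k x * t)) : f = g :=
  LinearMap.ext fun t => tensorAlgebra_induction_left one
    (fun r t h => by rw [map_smul, map_smul, h]) (fun s t hs ht => by rw [map_add, map_add, hs, ht])
    ι_mul t

/-- The step `(t, n) ↦ (x ⊗ t, f x (t, n))` of the left recursion on `T(M)`. -/
def tensorRecStep (f : M →ₗ[k] TensorAlgebra k M × N →ₗ[k] N) :
    M →ₗ[k] Module.End k (TensorAlgebra k M × N) :=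
  LinearMap.mk₂ k (fun x p => (ι k x * p.1, f x p))
    (by simp [add_mul]) (by simp) (by simp [mul_add]) (by simp)

/-- The linear map `F` on `T(M)` defined by left recursion: `F 1 = n` and
`F (x ⊗ t) = f x (t, F t)`. -/
def tensorRec (f : M →ₗ[k] TensorAlgebra k M × N →ₗ[k] N) (n : N) : TensorAlgebra k M →ₗ[k] N :=
  LinearMap.snd k _ _ ∘ₗ (TensorAlgebra.lift k (tensorRecStep f)).toLinearMap.flip (1, n)

variable (f : M →ₗ[k] TensorAlgebra k M × N →ₗ[k] N) (n : N)

@[simp]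
theorem tensorRec_one : tensorRec f n 1 = n := by simp [tensorRec]

theorem lift_tensorRecStep (t : TensorAlgebra k M) :
    TensorAlgebra.lift k (tensorRecStep f) t (1, n) = (t, tensorRec f n t) := by
  suffices h : LinearMap.fst k _ _ ∘ₗ
      (TensorAlgebra.lift k (tensorRecStep f)).toLinearMap.flip (1, n) = LinearMap.id from
    Prod.ext (LinearMap.congr_fun h t) rfl
  refine tensorAlgebra_linearMap_ext (by simp) fun x t ih => ?_
  simpa [tensorRecStep] using congrArg (ι k x * ·) ih

theorem tensorRec_ι_mul (x : M) (t : TensorAlgebra k M) :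
    tensorRec f n (ι k x * t) = f x (t, tensorRec f n t) := by
  rw [← lift_tensorRecStep f n t]
  simp [tensorRec, tensorRecStep]

end LeftRecursion

/-! ### The bar differential on the tensor algebra -/

section TensorBar

variable {k B : Type*} [CommRing k] [Ring B] [Algebra k B]

/-- Left multiplication of the first tensor factor, `a ↦ (x ⊗ t ↦ a x ⊗ t)`; it kills the component
of degree zero of `T(B)`. -/
def mulHead : B →ₗ[k] TensorAlgebra k B →ₗ[k] TensorAlgebra k B :=
  (tensorRec (N := B →ₗ[k] TensorAlgebra k B)
    (LinearMap.mk₂ k (fun x p => LinearMap.mulRight k p.1 ∘ₗ ι k ∘ₗ LinearMap.mulRight k x)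
      (fun x y p => by ext; simp [mul_add, add_mul]) (fun r x p => by ext; simp)
      (fun x p q => by ext; simp [mul_add]) (fun r x p => by ext; simp)) 0).flip

@[simp]
theorem mulHead_one (a : B) : mulHead (k := k) a 1 = 0 := by simp [mulHead]

@[simp]
theorem mulHead_ι_mul (a x : B) (t : TensorAlgebra k B) :
    mulHead a (ι k x * t) = ι k (a * x) * t := by
  simp [mulHead, tensorRec_ι_mul]

theorem mulHead_mulHead (a x : B) (t : TensorAlgebra k B) :
    mulHead a (mulHead x t) = mulHead (a * x) t := by
  suffices h : mulHead (k := k) a ∘ₗ mulHead x = mulHead (a * x) from LinearMap.congr_fun h t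
  exact tensorAlgebra_linearMap_ext (by simp) fun y t _ => by simp [mul_assoc]

/-- The bar differential on `T(B)`, `d (x ⊗ t) = x · t - x ⊗ d t`, where `x` multiplies the first
factor of `t`. On `B^{⊗ (n + 1)}` it agrees with `barD`. -/
def tensorBarD : TensorAlgebra k B →ₗ[k] TensorAlgebra k B :=
  tensorRec (mulHead.compl₂ (LinearMap.fst k _ _) -
    (LinearMap.mul k (TensorAlgebra k B) ∘ₗ ι k).compl₂ (LinearMap.snd k _ _)) 0

@[simp]
theorem tensorBarD_one : tensorBarD (1 : TensorAlgebra k B) = 0 := tensorRec_one _ _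

theorem tensorBarD_ι_mul (x : B) (t : TensorAlgebra k B) :
    tensorBarD (ι k x * t) = mulHead x t - ι k x * tensorBarD t := by
  simp [tensorBarD, tensorRec_ι_mul]

theorem tensorBarD_mulHead (a : B) (t : TensorAlgebra k B) :
    tensorBarD (mulHead a t) = mulHead a (tensorBarD t) := by
  suffices h : tensorBarD ∘ₗ mulHead a = mulHead (k := k) a ∘ₗ tensorBarD from
    LinearMap.congr_fun h t
  exact tensorAlgebra_linearMap_ext (by simp) fun y t _ => by
    simp [tensorBarD_ι_mul, mulHead_mulHead]

theorem tensorBarD_tensorBarD (t : TensorAlgebra k B) : tensorBarD (tensorBarD t) = 0 := by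
  suffices h : tensorBarD (k := k) (B := B) ∘ₗ tensorBarD = 0 from LinearMap.congr_fun h t
  refine tensorAlgebra_linearMap_ext (by simp) fun x t ih => ?_
  have ih' : tensorBarD (tensorBarD t) = 0 := ih
  simp [tensorBarD_ι_mul, tensorBarD_mulHead, ih']

end TensorBar

section BarComparison

variable {k B : Type*} [Field k] [Ring B] [Algebra k B]

theorem face_zero {n : ℕ} (a : Fin (n + 2) → B) :
    face 0 a = Fin.cons (a 0 * a 1) (Fin.tail (Fin.tail a)) := by
  funext i
  cases i using Fin.cases <;> simp [face, Fin.contractNth, Fin.tail]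

theorem face_succ {n : ℕ} (j : Fin n) (a : Fin (n + 2) → B) :
    face j.succ a = Fin.cons (a 0) (face j (Fin.tail a)) := by
  funext i
  cases i using Fin.cases <;> simp [face, Fin.contractNth, Fin.tail]

theorem tprod_succ {n : ℕ} (a : Fin (n + 1) → B) :
    TensorAlgebra.tprod k B (n + 1) a = ι k (a 0) * TensorAlgebra.tprod k B n (Fin.tail a) := by
  simp [TensorAlgebra.tprod_apply, List.ofFn_succ, Fin.tail]

theorem tensorBarD_tprod (n : ℕ) (a : Fin (n + 1) → B) :
    tensorBarD (TensorAlgebra.tprod k B (n + 1) a) =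
      ∑ j : Fin n, (-1 : k) ^ (j : ℕ) • TensorAlgebra.tprod k B n (face j a) := by
  induction n with
  | zero => rw [tprod_succ, tensorBarD_ι_mul]; simp [TensorAlgebra.tprod_apply]
  | succ n ih =>
    rw [tprod_succ, tensorBarD_ι_mul, ih, Fin.sum_univ_succ, face_zero, tprod_succ (Fin.tail a),
      mulHead_ι_mul, tprod_succ]
    simp only [face_succ, tprod_succ (Fin.cons _ _), Fin.cons_zero, Fin.tail_cons]
    simp [pow_succ, Finset.mul_sum, sub_eq_add_neg, Fin.tail]

theorem toTensorAlgebra_barD (n : ℕ) (x : ⨂[k] _ : Fin (n + 1), B) :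
    TensorPower.toTensorAlgebra (barD k B n x) = tensorBarD (TensorPower.toTensorAlgebra x) := by
  suffices h : TensorPower.toTensorAlgebra ∘ₗ barD k B n =
      tensorBarD ∘ₗ TensorPower.toTensorAlgebra from LinearMap.congr_fun h x
  refine PiTensorProduct.ext (MultilinearMap.ext fun a => ?_)
  simp only [LinearMap.compMultilinearMap_apply, LinearMap.comp_apply,
    TensorPower.toTensorAlgebra_tprod, tensorBarD_tprod, barD, LinearMap.sum_apply,
    LinearMap.smul_apply, PiTensorProduct.lift.tprod, map_sum, map_smul]
  exact Finset.sum_congr rfl fun j _ => congrArg _ (TensorPower.toTensorAlgebra_tprod _)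

end BarComparison

theorem toTensorAlgebra_injective {k M : Type*} [CommSemiring k] [AddCommMonoid M] [Module k M]
    (n : ℕ) : Function.Injective (TensorPower.toTensorAlgebra : (⨂[k]^n) M →ₗ[k] _) := by
  have toDirectSum_eq (z : (⨂[k]^n) M) : TensorAlgebra.toDirectSum
      (TensorPower.toTensorAlgebra z) = DirectSum.of (fun n => (⨂[k]^n) M) n z := by
    rw [← TensorAlgebra.toDirectSum_ofDirectSum (DirectSum.of _ n z)]
    exact congrArg _ (DirectSum.toAddMonoid_of
      (fun _ ↦ LinearMap.toAddMonoidHom TensorPower.toTensorAlgebra) _ _).symm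
  intro x y h
  apply DirectSum.of_injective (β := fun n => (⨂[k]^n) M) n
  rw [← toDirectSum_eq, h, toDirectSum_eq]

/-! ### Words in a basis -/

section Words

variable {k M N : Type*} [CommSemiring k] [AddCommMonoid M] [Module k M]
  (b : Module.Basis N k M)

/-- The basis of `T(M)` formed by the words in a basis of `M`, indexed by lists. -/
def wordBasis : Module.Basis (List N) k (TensorAlgebra k M) :=
  b.tensorAlgebra.reindex FreeMonoid.toList

theorem wordBasis_eq_prod (l : List N) : wordBasis b l = (l.map fun i => ι k (b i)).prod := by
  have toFreeAlgebra : wordBasis b l = (TensorAlgebra.equivFreeAlgebra b).symm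
      (FreeAlgebra.equivMonoidAlgebraFreeMonoid.symm
        (MonoidAlgebra.single (FreeMonoid.ofList l) 1)) := by
    simp [wordBasis, Module.Basis.tensorAlgebra, FreeAlgebra.basisFreeMonoid]
  have freeAlgebra_word : FreeAlgebra.equivMonoidAlgebraFreeMonoid.symm
      (MonoidAlgebra.single (FreeMonoid.ofList l) (1 : k)) = (l.map (FreeAlgebra.ι k)).prod := by
    rw [FreeAlgebra.equivMonoidAlgebraFreeMonoid]
    exact (MonoidAlgebra.lift_single _ _ _).trans (by simp [FreeMonoid.lift_apply])
  rw [toFreeAlgebra, freeAlgebra_word, map_list_prod, List.map_map]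
  exact congrArg _ (List.map_congr_left fun i _ => TensorAlgebra.equivFreeAlgebra_symm_ι b i)

@[simp]
theorem wordBasis_nil : wordBasis b [] = 1 := by simp [wordBasis_eq_prod]

theorem wordBasis_cons (i : N) (l : List N) :
    wordBasis b (i :: l) = ι k (b i) * wordBasis b l := by simp [wordBasis_eq_prod]

theorem wordBasis_append (l l' : List N) :
    wordBasis b (l ++ l') = wordBasis b l * wordBasis b l' := by simp [wordBasis_eq_prod]

/-- The span of the words that belong to `L`. -/
def wordSpan (L : Set (List N)) : Submodule k (TensorAlgebra k M) :=
  Submodule.span k (wordBasis b '' L)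

variable {b} {L L' : Set (List N)}

theorem wordBasis_mem_wordSpan {l : List N} (hl : l ∈ L) : wordBasis b l ∈ wordSpan b L :=
  Submodule.subset_span ⟨l, hl, rfl⟩

theorem wordSpan_mono (h : L ⊆ L') : wordSpan b L ≤ wordSpan b L' :=
  Submodule.span_mono (Set.image_mono h)

theorem wordSpan_le {P : Submodule k (TensorAlgebra k M)} :
    wordSpan b L ≤ P ↔ ∀ l ∈ L, wordBasis b l ∈ P := by
  simp [wordSpan, Submodule.span_le, Set.subset_def]

theorem map_mem_of_mem_wordSpan {E : Type*} [AddCommMonoid E] [Module k E]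
    {f : TensorAlgebra k M →ₗ[k] E} {P : Submodule k E} (h : ∀ l ∈ L, f (wordBasis b l) ∈ P)
    {t : TensorAlgebra k M} (ht : t ∈ wordSpan b L) : f t ∈ P :=
  (wordSpan_le (P := P.comap f)).2 h ht

theorem mem_wordSpan_iff {t : TensorAlgebra k M} :
    t ∈ wordSpan b L ↔ ∀ l, (wordBasis b).repr t l ≠ 0 → l ∈ L := by
  simp [wordSpan, Module.Basis.mem_span_image, Set.subset_def]

theorem wordSpan_union : wordSpan b (L ∪ L') = wordSpan b L ⊔ wordSpan b L' := by
  rw [wordSpan, Set.image_union, Submodule.span_union, wordSpan, wordSpan]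

theorem wordSpan_univ : wordSpan b Set.univ = ⊤ := by
  rw [wordSpan, Set.image_univ, (wordBasis b).span_eq]

theorem wordSpan_singleton (l : List N) : wordSpan b {l} = Submodule.span k {wordBasis b l} := by
  rw [wordSpan, Set.image_singleton]

theorem wordSpan_mul_wordSpan :
    wordSpan b L * wordSpan b L' = wordSpan b (Set.image2 (· ++ ·) L L') := by
  rw [wordSpan, wordSpan, Submodule.span_mul_span, ← Set.image2_mul, wordSpan,
    Set.image_image2_distrib (wordBasis_append b)]

theorem mul_mem_wordSpan {P : Set (List N)} (h : ∀ l ∈ L, ∀ l' ∈ L', l ++ l' ∈ P)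
    {s t : TensorAlgebra k M} (hs : s ∈ wordSpan b L) (ht : t ∈ wordSpan b L') :
    s * t ∈ wordSpan b P :=
  wordSpan_mono (Set.image2_subset_iff.2 h)
    (wordSpan_mul_wordSpan (b := b) ▸ Submodule.mul_mem_mul hs ht)

theorem range_ι_pow_eq_wordSpan (n : ℕ) :
    LinearMap.range (ι k : M →ₗ[k] _) ^ n = wordSpan b {l | l.length = n} := by
  have range_ι_eq : LinearMap.range (ι k : M →ₗ[k] _) = wordSpan b (Set.range ([·])) := by
    rw [LinearMap.range_eq_map, ← b.span_eq, Submodule.map_span, ← Set.range_comp, wordSpan,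
      ← Set.range_comp]
    simp [Function.comp_def, wordBasis_cons]
  induction n with
  | zero => simp [wordSpan_singleton, Submodule.one_eq_span]
  | succ n ih =>
    rw [pow_succ', ih, range_ι_eq, wordSpan_mul_wordSpan]
    congr 1
    ext (_ | ⟨i, l⟩) <;> simp

end Words

/-! ### The degree-lexicographical order -/

section WordOrder

variable {X : Type*} [LinearOrder X]

/-- The degree-lexicographical order on words, the larger letters being the smaller elements of
`X` as in `DegLexLT`. -/
def WordLT (u w : List X) : Prop := List.Shortlex (fun i j : X => j < i) u w

/-- The words of the same length as `w` which are smaller than `w`. -/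
def lowerWords (w : List X) : Set (List X) := {u | u.length = w.length ∧ WordLT u w}

/-- The number of words of the same length which are smaller than `w`. -/
def wordRank (w : List X) : ℕ := (lowerWords w).ncard

variable {u v w : List X}

theorem WordLT.trans (h : WordLT u v) (h' : WordLT v w) : WordLT u w := by
  have lex_isTrans : IsTrans (List X) (List.Lex fun i j => j < i) :=
    isStrictWeakOrder_of_isOrderConnected.toIsStrictOrder.toIsTrans
  rw [WordLT, List.shortlex_def] at *
  rcases h with h | ⟨hlen, h⟩ <;> rcases h' with h' | ⟨hlen', h'⟩
  · exact .inl (h.trans h')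
  · exact .inl (by omega)
  · exact .inl (by omega)
  · exact .inr ⟨hlen.trans hlen', lex_isTrans.trans _ _ _ h h'⟩

theorem WordLT.length_le (h : WordLT u w) : u.length ≤ w.length := by
  rw [WordLT, List.shortlex_def] at h
  exact h.elim le_of_lt fun h => h.1.le

instance : IsStrictTotalOrder (List X) WordLT where
  trichotomous := (List.Shortlex.trichotomous (r := fun i j : X => j < i)).trichotomous
  irrefl w h := (List.Shortlex.asymm (r := fun i j : X => j < i)).asymm w w h h
  trans _ _ _ := WordLT.trans

theorem wordLT_wellFounded [Finite X] : WellFounded (WordLT (X := X)) :=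
  List.Shortlex.wf (Finite.wellFounded_of_trans_of_irrefl _)

theorem exists_greatest_word (s : Finset (List X)) (hs : s.Nonempty) :
    ∃ w ∈ s, ∀ u ∈ s, u ≠ w → WordLT u w := by
  have wf : (s : Set (List X)).WellFoundedOn (Function.swap WordLT) :=
    s.finite_toSet.wellFoundedOn
  obtain ⟨⟨w, hw⟩, -, hmax⟩ := wf.has_min Set.univ ⟨⟨_, hs.choose_spec⟩, trivial⟩
  exact ⟨w, hw, fun u hu hne =>
    (trichotomous_of WordLT u w).resolve_right (not_or.2 ⟨hne, hmax ⟨u, hu⟩ trivial⟩)⟩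

theorem length_of_mem_insert_lowerWords (h : u ∈ insert w (lowerWords w)) :
    u.length = w.length := by
  rcases h with rfl | h
  exacts [rfl, h.1]

theorem nil_notMem_insert_lowerWords (hw : w ≠ []) : [] ∉ insert w (lowerWords w) := fun h =>
  hw (List.length_eq_zero_iff.1 (length_of_mem_insert_lowerWords h).symm)

theorem lowerWords_subset (h : u ∈ lowerWords w) : lowerWords u ⊆ lowerWords w :=
  fun _ hv => ⟨hv.1.trans h.1, hv.2.trans h.2⟩

theorem append_left_mem_lowerWords (p : List X) (h : u ∈ lowerWords w) :
    p ++ u ∈ lowerWords (p ++ w) :=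
  ⟨by simp [h.1], List.Shortlex.append_left h.2 p⟩

theorem append_right_mem_lowerWords (s : List X) (h : u ∈ lowerWords w) :
    u ++ s ∈ lowerWords (w ++ s) := by
  obtain ⟨hlen, hlt⟩ := h
  refine ⟨by simp [hlen], (List.shortlex_iff_lex (by simp [hlen])).2 ?_⟩
  replace hlt := (List.shortlex_iff_lex hlen).1 hlt
  induction hlt with
  | nil => simp at hlen
  | cons _ ih => exact .cons (ih (by simpa using hlen))
  | rel h => exact .rel h

theorem append_left_mem_insert_lowerWords (p : List X) (h : u ∈ insert w (lowerWords w)) :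
    p ++ u ∈ insert (p ++ w) (lowerWords (p ++ w)) :=
  h.imp (congrArg _) (append_left_mem_lowerWords p)

theorem append_right_mem_insert_lowerWords (s : List X) (h : u ∈ insert w (lowerWords w)) :
    u ++ s ∈ insert (w ++ s) (lowerWords (w ++ s)) :=
  h.imp (congrArg (· ++ s)) (append_right_mem_lowerWords s)

theorem wordRank_lt_wordRank [Finite X] (h : u ∈ lowerWords w) : wordRank u < wordRank w :=
  Set.ncard_lt_ncard ⟨lowerWords_subset h, fun h' => irrefl_of WordLT u (h' h).2⟩
    ((List.finite_length_eq X w.length).subset fun _ hv => hv.1)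

end WordOrder

/-! ### Bases of normal words -/

section NormalWords

variable {X : Type*} {S : X → X → Prop}

/-- The words without two consecutive letters in the relation `S`. -/
def IsNormal (S : X → X → Prop) (w : List X) : Prop := w.IsChain fun x y => ¬ S x y

/-- The type of normal words. -/
abbrev NormalWord (S : X → X → Prop) : Type _ := {w : List X // IsNormal S w}

theorem isNormal_nil : IsNormal S [] := List.isChain_nil

theorem isNormal_singleton (x : X) : IsNormal S [x] := List.isChain_singleton x

theorem isNormal_cons_cons {x y : X} {w : List X} :
    IsNormal S (x :: y :: w) ↔ ¬ S x y ∧ IsNormal S (y :: w) := List.isChain_cons_cons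

/-- The normal word of one letter. -/
def letter (S : X → X → Prop) (x : X) : NormalWord S := ⟨[x], isNormal_singleton x⟩

/-- The concatenation of a list of normal words. -/
def concat (l : List (NormalWord S)) : List X := (l.map Subtype.val).flatten

@[simp]
theorem concat_nil : concat ([] : List (NormalWord S)) = [] := rfl

@[simp]
theorem concat_cons (u : NormalWord S) (l : List (NormalWord S)) :
    concat (u :: l) = u.1 ++ concat l := rfl

variable {k B : Type*} [CommRing k] [Ring B] [Algebra k B]

/-- The span of the elements of `b` indexed by the normal words that belong to `P`. -/
def normalSpan (b : Module.Basis (NormalWord S) k B) (P : Set (List X)) : Submodule k B :=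
  Submodule.span k (b '' {u | u.1 ∈ P})

/-- The span of the words `b u₁ ⊗ ⋯ ⊗ b uₙ` such that the `uᵢ` are nonempty and their concatenation
belongs to `Q`: the part of the reduced bar complex supported on the words of `Q`. -/
def barSpan (b : Module.Basis (NormalWord S) k B) (n : ℕ) (Q : Set (List X)) :
    Submodule k (TensorAlgebra k B) :=
  wordSpan b {l | l.length = n ∧ (∀ u ∈ l, u.1 ≠ []) ∧ concat l ∈ Q}

variable {b : Module.Basis (NormalWord S) k B} {n : ℕ} {P Q Q' : Set (List X)}

theorem basis_mem_normalSpan {u : NormalWord S} (hu : u.1 ∈ P) : b u ∈ normalSpan b P :=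
  Submodule.subset_span ⟨u, hu, rfl⟩

theorem normalSpan_mono (h : P ⊆ Q) : normalSpan b P ≤ normalSpan b Q :=
  Submodule.span_mono (Set.image_mono fun _ hu => h hu)

theorem wordBasis_mem_barSpan {l : List (NormalWord S)} (hne : ∀ u ∈ l, u.1 ≠ [])
    (hQ : concat l ∈ Q) : wordBasis b l ∈ barSpan b l.length Q :=
  wordBasis_mem_wordSpan ⟨rfl, hne, hQ⟩

theorem barSpan_mono (h : Q ⊆ Q') : barSpan b n Q ≤ barSpan b n Q' :=
  wordSpan_mono fun _ hl => ⟨hl.1, hl.2.1, h hl.2.2⟩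

theorem barSpan_insert (w : List X) :
    barSpan b n (insert w Q) = barSpan b n {w} ⊔ barSpan b n Q := by
  rw [barSpan, barSpan, barSpan, ← wordSpan_union]
  congr 1
  ext l
  simp only [Set.mem_insert_iff, Set.mem_ofPred_eq, Set.mem_union, Set.mem_singleton_iff]
  tauto

theorem ι_mul_mem_barSpan (hP : [] ∉ P) {a : B} {t : TensorAlgebra k B} (ha : a ∈ normalSpan b P)
    (ht : t ∈ barSpan b n Q) (h : ∀ u ∈ P, ∀ w ∈ Q, u ++ w ∈ Q') :
    ι k a * t ∈ barSpan b (n + 1) Q' := by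
  suffices ha' : ι k a ∈ wordSpan b ((fun u => [u]) '' {u | u.1 ∈ P}) by
    refine mul_mem_wordSpan ?_ ha' ht
    rintro _ ⟨u, hu, rfl⟩ l ⟨rfl, hne, hQ⟩
    exact ⟨rfl, List.forall_mem_cons.2 ⟨fun h0 => hP (h0 ▸ hu), hne⟩, h u.1 hu _ hQ⟩
  refine (Submodule.span_le (p := (wordSpan b _).comap (ι k))).2 ?_ ha
  rintro _ ⟨u, hu, rfl⟩
  simpa [wordBasis_cons] using
    wordBasis_mem_wordSpan (b := b) (Set.mem_image_of_mem (fun u => [u]) hu)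

theorem ι_basis_mul_mem_barSpan {u : NormalWord S} {t : TensorAlgebra k B} (hu : u.1 ≠ [])
    (ht : t ∈ barSpan b n Q) (h : ∀ w ∈ Q, u.1 ++ w ∈ Q') :
    ι k (b u) * t ∈ barSpan b (n + 1) Q' :=
  ι_mul_mem_barSpan (P := {u.1}) (by simpa using hu.symm) (basis_mem_normalSpan rfl) ht
    (by rintro _ rfl; exact h)

theorem ι_letter_mul_mem_barSpan {x : X} {t : TensorAlgebra k B} (ht : t ∈ barSpan b n Q)
    (h : ∀ w ∈ Q, x :: w ∈ Q') : ι k (b (letter S x)) * t ∈ barSpan b (n + 1) Q' :=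
  ι_basis_mul_mem_barSpan (List.cons_ne_nil x []) ht h

end NormalWords

/-! ### The homotopy -/

section Homotopy

variable {X : Type*} {S : X → X → Prop} {k B : Type*} [CommRing k] [Ring B] [Algebra k B]
  (b : Module.Basis (NormalWord S) k B)

open Classical in
/-- The homotopy of the bar complex, on words in the basis `b`. It splits off the first letter of
the first factor of length at least two, provided that the factors before it are letters each of
which forms a pair in `S` with the letter that follows it. -/
def homotopyWord : List (NormalWord S) → TensorAlgebra k B
  | [] => 0
  | ⟨[], _⟩ :: _ => 0
  | ⟨[x], _⟩ :: l =>
    if ∃ y ∈ (concat l).head?, S x y then -(ι k (b (letter S x)) * homotopyWord l) else 0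
  | ⟨x :: y :: w, h⟩ :: l =>
    ι k (b (letter S x)) * (ι k (b ⟨y :: w, (isNormal_cons_cons.1 h).2⟩) * wordBasis b l)

/-- The homotopy of the bar complex of an algebra with a basis of normal words. -/
def homotopy : TensorAlgebra k B →ₗ[k] TensorAlgebra k B :=
  (wordBasis b).constr k (homotopyWord b)

/-- The difference `d h + h d - 1`, which measures how far `homotopy` is from being a
contraction. -/
def homotopyDefect : TensorAlgebra k B →ₗ[k] TensorAlgebra k B :=
  tensorBarD ∘ₗ homotopy b + homotopy b ∘ₗ tensorBarD - LinearMap.id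

variable {b} {n : ℕ} {Q : Set (List X)}

theorem homotopyDefect_apply (t : TensorAlgebra k B) :
    homotopyDefect b t = tensorBarD (homotopy b t) + homotopy b (tensorBarD t) - t := rfl

theorem homotopy_wordBasis (l : List (NormalWord S)) :
    homotopy b (wordBasis b l) = homotopyWord b l := Module.Basis.constr_basis _ _ _ _

open Classical in
theorem homotopy_wordBasis_letter_cons (x : X) (l : List (NormalWord S)) :
    homotopy b (wordBasis b (letter S x :: l)) = if ∃ y ∈ (concat l).head?, S x y then
      -(ι k (b (letter S x)) * homotopy b (wordBasis b l)) else 0 := by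
  rw [homotopy_wordBasis, homotopy_wordBasis]
  conv_lhs => unfold letter homotopyWord

theorem homotopy_ι_mul {x y : X} {w : List X} (h : IsNormal S (x :: y :: w))
    (t : TensorAlgebra k B) :
    homotopy b (ι k (b ⟨x :: y :: w, h⟩) * t) =
      ι k (b (letter S x)) * (ι k (b ⟨y :: w, (isNormal_cons_cons.1 h).2⟩) * t) := by
  suffices h' : homotopy b ∘ₗ LinearMap.mulLeft k (ι k (b ⟨x :: y :: w, h⟩)) =
      LinearMap.mulLeft k (ι k (b (letter S x))) ∘ₗ
        LinearMap.mulLeft k (ι k (b ⟨y :: w, (isNormal_cons_cons.1 h).2⟩)) from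
    LinearMap.congr_fun h' t
  refine (wordBasis b).ext fun l => ?_
  simp only [LinearMap.comp_apply, LinearMap.mulLeft_apply]
  rw [← wordBasis_cons, homotopy_wordBasis, homotopyWord]

theorem homotopy_ι_letter_mul_of_rel {x y : X} {w : List X} (hxy : S x y) {t : TensorAlgebra k B}
    (ht : t ∈ barSpan b n {y :: w}) :
    homotopy b (ι k (b (letter S x)) * t) = -(ι k (b (letter S x)) * homotopy b t) := by
  refine LinearMap.eqOn_span (f := homotopy b ∘ₗ LinearMap.mulLeft k (ι k (b (letter S x))))
    (g := -(LinearMap.mulLeft k (ι k (b (letter S x))) ∘ₗ homotopy b)) ?_ ht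
  rintro _ ⟨l, ⟨-, -, hl : concat l = y :: w⟩, rfl⟩
  change homotopy b (ι k (b (letter S x)) * wordBasis b l) = -(_ * homotopy b (wordBasis b l))
  rw [← wordBasis_cons, homotopy_wordBasis_letter_cons, if_pos ⟨y, by simp [hl], hxy⟩]

theorem homotopy_ι_letter_mul_of_not_rel {x y : X} {w : List X} (hxy : ¬ S x y)
    {t : TensorAlgebra k B} (ht : t ∈ barSpan b n {y :: w}) :
    homotopy b (ι k (b (letter S x)) * t) = 0 := by
  refine LinearMap.eqOn_span (f := homotopy b ∘ₗ LinearMap.mulLeft k (ι k (b (letter S x))))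
    (g := 0) ?_ ht
  rintro _ ⟨l, ⟨-, -, hl : concat l = y :: w⟩, rfl⟩
  change homotopy b (ι k (b (letter S x)) * wordBasis b l) = 0
  rw [← wordBasis_cons, homotopy_wordBasis_letter_cons, if_neg (by simpa [hl] using hxy)]

theorem homotopyWord_mem_barSpan {l : List (NormalWord S)} (hl : ∀ v ∈ l, v.1 ≠ []) :
    homotopyWord b l ∈ barSpan b (l.length + 1) {concat l} := by
  induction l with
  | nil => simp [homotopyWord]
  | cons u l ih =>
    have hl' := (List.forall_mem_cons.1 hl).2
    rcases u with ⟨_ | ⟨x, _ | ⟨y, w⟩⟩, h⟩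
    · simp [homotopyWord]
    · rw [homotopyWord]
      split_ifs
      · exact neg_mem (ι_letter_mul_mem_barSpan (ih hl') fun w hw => congrArg (x :: ·) hw)
      · exact zero_mem _
    · rw [homotopyWord, ← wordBasis_cons, ← wordBasis_cons]
      exact wordBasis_mem_barSpan (l := letter S x :: ⟨y :: w, (isNormal_cons_cons.1 h).2⟩ :: l)
        (by simpa [letter] using hl') rfl

theorem homotopy_mem_barSpan {t : TensorAlgebra k B} (ht : t ∈ barSpan b n Q) :
    homotopy b t ∈ barSpan b (n + 1) Q := by
  refine map_mem_of_mem_wordSpan ?_ ht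
  rintro l ⟨rfl, hne, hQ⟩
  rw [homotopy_wordBasis]
  exact barSpan_mono (Set.singleton_subset_iff.2 hQ) (homotopyWord_mem_barSpan hne)

end Homotopy

/-! ### PBW bases -/

/-- A basis of an algebra, indexed by the words which are normal with respect to a set `S` of pairs
of letters, such that products of basis elements are concatenations up to smaller words. -/
structure IsPBWBasis {X k B : Type*} [LinearOrder X] {S : X → X → Prop} [CommRing k] [Ring B]
    [Algebra k B] (b : Module.Basis (NormalWord S) k B) : Prop where
  one : b ⟨[], isNormal_nil⟩ = 1
  mul_of_isNormal : ∀ (u v : NormalWord S) (h : IsNormal S (u.1 ++ v.1)),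
    b u * b v = b ⟨u.1 ++ v.1, h⟩
  mul_of_not_isNormal : ∀ u v : NormalWord S, ¬ IsNormal S (u.1 ++ v.1) →
    b u * b v ∈ normalSpan b (lowerWords (u.1 ++ v.1))

namespace IsPBWBasis

variable {X k B : Type*} [LinearOrder X] {S : X → X → Prop} [CommRing k] [Ring B] [Algebra k B]
  {b : Module.Basis (NormalWord S) k B} {n : ℕ} {x y : X} {w : List X} {t : TensorAlgebra k B}

theorem basis_mul_mem (hb : IsPBWBasis b) (u v : NormalWord S) :
    b u * b v ∈ normalSpan b (insert (u.1 ++ v.1) (lowerWords (u.1 ++ v.1))) := by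
  by_cases h : IsNormal S (u.1 ++ v.1)
  · rw [hb.mul_of_isNormal u v h]
    exact basis_mem_normalSpan (.inl rfl)
  · exact normalSpan_mono (Set.subset_insert _ _) (hb.mul_of_not_isNormal u v h)

theorem mulHead_mem_barSpan (hb : IsPBWBasis b) {u : NormalWord S} (hu : u.1 ≠ [])
    (ht : t ∈ barSpan b n {w}) :
    mulHead (b u) t ∈ barSpan b n (insert (u.1 ++ w) (lowerWords (u.1 ++ w))) := by
  refine map_mem_of_mem_wordSpan ?_ ht
  rintro l ⟨rfl, hne, rfl⟩
  cases l with
  | nil => simp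
  | cons v l =>
    rw [wordBasis_cons, mulHead_ι_mul]
    refine ι_mul_mem_barSpan (nil_notMem_insert_lowerWords (by simp [hu])) (hb.basis_mul_mem u v)
      (wordBasis_mem_barSpan (Q := {concat l}) (List.forall_mem_cons.1 hne).2 rfl) ?_
    rintro w hw _ rfl
    simpa using append_right_mem_insert_lowerWords (concat l) hw

theorem ι_mul_mul_mem_barSpan (hb : IsPBWBasis b) {u v : NormalWord S} (hu : u.1 ≠ [])
    (huv : ¬ IsNormal S (u.1 ++ v.1)) (ht : t ∈ barSpan b n {w}) :
    ι k (b u * b v) * t ∈ barSpan b (n + 1) (lowerWords (u.1 ++ v.1 ++ w)) := by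
  refine ι_mul_mem_barSpan
    (fun h => nil_notMem_insert_lowerWords (w := u.1 ++ v.1) (by simp [hu]) (.inr h))
    (hb.mul_of_not_isNormal u v huv) ht ?_
  rintro z hz _ rfl
  exact append_right_mem_lowerWords _ hz

theorem mulHead_letter_mem_barSpan (hb : IsPBWBasis b) (hxy : S x y)
    (ht : t ∈ barSpan b n {y :: w}) :
    mulHead (b (letter S x)) t ∈ barSpan b n (lowerWords (x :: y :: w)) := by
  refine map_mem_of_mem_wordSpan ?_ ht
  rintro (_ | ⟨⟨_ | ⟨z, v⟩, hv⟩, l⟩) ⟨rfl, hne, hl⟩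
  · simp
  · simp at hne
  · obtain ⟨rfl, rfl⟩ : z = y ∧ v ++ concat l = w := by simpa using hl
    rw [wordBasis_cons, mulHead_ι_mul]
    have hl : wordBasis b l ∈ barSpan b l.length {concat l} :=
      wordBasis_mem_barSpan (List.forall_mem_cons.1 hne).2 rfl
    exact hb.ι_mul_mul_mem_barSpan (u := letter S x) (v := ⟨z :: v, hv⟩) (List.cons_ne_nil x [])
      (fun h => (isNormal_cons_cons.1 h).1 hxy) hl

theorem tensorBarD_wordBasis_mem_barSpan (hb : IsPBWBasis b) {l : List (NormalWord S)}
    (hl : ∀ v ∈ l, v.1 ≠ []) (hn : l.length = n + 1) :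
    tensorBarD (wordBasis b l) ∈ barSpan b n (insert (concat l) (lowerWords (concat l))) := by
  induction l generalizing n with
  | nil => simp at hn
  | cons u l ih =>
    obtain ⟨hu, hl'⟩ := List.forall_mem_cons.1 hl
    obtain rfl : l.length = n := by simpa using hn
    rw [wordBasis_cons, tensorBarD_ι_mul]
    refine sub_mem (hb.mulHead_mem_barSpan hu (wordBasis_mem_barSpan hl' rfl)) ?_
    rcases l with _ | ⟨v, l⟩
    · simp
    · exact ι_basis_mul_mem_barSpan hu (ih hl' rfl) fun w hw =>
        append_left_mem_insert_lowerWords u.1 hw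

theorem tensorBarD_mem_barSpan (hb : IsPBWBasis b) (ht : t ∈ barSpan b (n + 1) {w}) :
    tensorBarD t ∈ barSpan b n (insert w (lowerWords w)) := by
  refine map_mem_of_mem_wordSpan ?_ ht
  rintro l ⟨hn, hne, rfl⟩
  exact hb.tensorBarD_wordBasis_mem_barSpan hne hn

end IsPBWBasis

namespace IsPBWBasis

variable {X k B : Type*} [LinearOrder X] {S : X → X → Prop} [CommRing k] [Ring B] [Algebra k B]
  {b : Module.Basis (NormalWord S) k B} {n : ℕ} {x y : X} {w : List X} {t : TensorAlgebra k B}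

theorem homotopyDefect_ι_mul (hb : IsPBWBasis b) (hw : IsNormal S (x :: y :: w))
    (t : TensorAlgebra k B) :
    homotopyDefect b (ι k (b ⟨x :: y :: w, hw⟩) * t) =
      homotopy b (mulHead (b ⟨x :: y :: w, hw⟩) t) -
        ι k (b (letter S x)) * mulHead (b ⟨y :: w, (isNormal_cons_cons.1 hw).2⟩) t := by
  have hx : b (letter S x) * b ⟨y :: w, (isNormal_cons_cons.1 hw).2⟩ = b ⟨x :: y :: w, hw⟩ :=
    hb.mul_of_isNormal (letter S x) ⟨y :: w, _⟩ hw
  simp only [homotopyDefect_apply, homotopy_ι_mul, tensorBarD_ι_mul, mulHead_ι_mul, hx, map_sub,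
    mul_sub]
  abel

theorem homotopyDefect_ι_mul_mem_barSpan (hb : IsPBWBasis b) {u : List X}
    (hu : IsNormal S (x :: y :: u)) (ht : t ∈ barSpan b n {w}) :
    homotopyDefect b (ι k (b ⟨x :: y :: u, hu⟩) * t) ∈
      barSpan b (n + 1) (lowerWords (x :: y :: u ++ w)) := by
  refine map_mem_of_mem_wordSpan
    (f := homotopyDefect b ∘ₗ LinearMap.mulLeft k (ι k (b ⟨x :: y :: u, hu⟩))) ?_ ht
  rintro (_ | ⟨v, l⟩) ⟨rfl, hne, rfl⟩
  · rw [LinearMap.comp_apply, LinearMap.mulLeft_apply, hb.homotopyDefect_ι_mul hu]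
    simp
  have hl : wordBasis b l ∈ barSpan b l.length {concat l} :=
    wordBasis_mem_barSpan (List.forall_mem_cons.1 hne).2 rfl
  have hu' := (isNormal_cons_cons.1 hu).2
  rw [LinearMap.comp_apply, LinearMap.mulLeft_apply, hb.homotopyDefect_ι_mul hu, wordBasis_cons,
    mulHead_ι_mul, mulHead_ι_mul]
  by_cases hn : IsNormal S (y :: u ++ v.1)
  · have hn' : IsNormal S (x :: y :: u ++ v.1) :=
      isNormal_cons_cons.2 ⟨(isNormal_cons_cons.1 hu).1, hn⟩
    rw [hb.mul_of_isNormal ⟨_, hu'⟩ v hn, hb.mul_of_isNormal ⟨_, hu⟩ v hn']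
    have split := homotopy_ι_mul (b := b) (w := u ++ v.1) hn' (wordBasis b l)
    simp only [List.cons_append] at split ⊢
    rw [split, sub_self]
    exact zero_mem _
  · have hn' : ¬ IsNormal S (x :: y :: u ++ v.1) := fun h => hn (isNormal_cons_cons.1 h).2
    have hu₁ := hb.ι_mul_mul_mem_barSpan (u := ⟨_, hu⟩) (List.cons_ne_nil _ _) hn' hl
    have hu₂ := hb.ι_mul_mul_mem_barSpan (u := ⟨_, hu'⟩) (List.cons_ne_nil _ _) hn hl
    rw [List.append_assoc] at hu₁ hu₂
    exact sub_mem (homotopy_mem_barSpan hu₁)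
      (ι_letter_mul_mem_barSpan hu₂ fun z hz => append_left_mem_lowerWords [x] hz)

theorem homotopyDefect_letter_mem_barSpan_of_rel (hb : IsPBWBasis b) (hxy : S x y)
    (ht : t ∈ barSpan b (n + 1) {y :: w})
    (hdefect : homotopyDefect b t ∈ barSpan b (n + 1) (lowerWords (y :: w))) :
    homotopyDefect b (ι k (b (letter S x)) * t) ∈
      barSpan b (n + 2) (lowerWords (x :: y :: w)) := by
  have hd := hb.tensorBarD_mem_barSpan ht
  rw [barSpan_insert] at hd
  obtain ⟨p, hp, q, hq, hpq⟩ := Submodule.mem_sup.1 hd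
  have ι_mul_mem {m : ℕ} {s : TensorAlgebra k B} (hs : s ∈ barSpan b m (lowerWords (y :: w))) :
      ι k (b (letter S x)) * s ∈ barSpan b (m + 1) (lowerWords (x :: y :: w)) :=
    ι_letter_mul_mem_barSpan hs fun z hz => append_left_mem_lowerWords [x] hz
  have expand : homotopyDefect b (ι k (b (letter S x)) * t) =
      ι k (b (letter S x)) * homotopyDefect b t - mulHead (b (letter S x)) (homotopy b t) +
        homotopy b (mulHead (b (letter S x)) t) - ι k (b (letter S x)) * homotopy b q -
        homotopy b (ι k (b (letter S x)) * q) := by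
    rw [homotopyDefect_apply, homotopyDefect_apply, homotopy_ι_letter_mul_of_rel hxy ht, map_neg,
      tensorBarD_ι_mul, tensorBarD_ι_mul, ← hpq, map_sub, mul_add, map_add,
      homotopy_ι_letter_mul_of_rel hxy hp, map_add]
    noncomm_ring
  rw [expand]
  exact sub_mem (sub_mem (add_mem (sub_mem (ι_mul_mem hdefect)
    (hb.mulHead_letter_mem_barSpan hxy (homotopy_mem_barSpan ht)))
    (homotopy_mem_barSpan (hb.mulHead_letter_mem_barSpan hxy ht)))
    (ι_mul_mem (homotopy_mem_barSpan hq))) (homotopy_mem_barSpan (ι_mul_mem hq))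

theorem homotopy_mulHead_letter (hb : IsPBWBasis b) (hxy : ¬ S x y)
    (ht : t ∈ barSpan b (n + 1) {y :: w}) :
    homotopy b (mulHead (b (letter S x)) t) = ι k (b (letter S x)) * t := by
  refine LinearMap.eqOn_span (f := homotopy b ∘ₗ mulHead (b (letter S x)))
    (g := LinearMap.mulLeft k (ι k (b (letter S x)))) ?_ ht
  rintro _ ⟨_ | ⟨⟨_ | ⟨z, v⟩, hv⟩, l⟩, ⟨hn, hne, hl⟩, rfl⟩
  · simp at hn
  · simp at hne
  · obtain rfl : z = y := by simpa using (List.cons.inj hl).1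
    have hn : IsNormal S (x :: z :: v) := isNormal_cons_cons.2 ⟨hxy, hv⟩
    rw [LinearMap.comp_apply, wordBasis_cons, mulHead_ι_mul,
      hb.mul_of_isNormal (letter S x) ⟨z :: v, hv⟩ hn]
    exact homotopy_ι_mul hn _

theorem homotopyDefect_letter_mem_barSpan_of_not_rel (hb : IsPBWBasis b) (hxy : ¬ S x y)
    (ht : t ∈ barSpan b (n + 1) {y :: w}) :
    homotopyDefect b (ι k (b (letter S x)) * t) ∈
      barSpan b (n + 2) (lowerWords (x :: y :: w)) := by
  have hd := hb.tensorBarD_mem_barSpan ht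
  rw [barSpan_insert] at hd
  obtain ⟨p, hp, q, hq, hpq⟩ := Submodule.mem_sup.1 hd
  have expand : homotopyDefect b (ι k (b (letter S x)) * t) =
      -homotopy b (ι k (b (letter S x)) * q) := by
    rw [homotopyDefect_apply, homotopy_ι_letter_mul_of_not_rel hxy ht, tensorBarD_ι_mul, ← hpq,
      map_sub, hb.homotopy_mulHead_letter hxy ht, mul_add, map_add,
      homotopy_ι_letter_mul_of_not_rel hxy hp]
    simp
  rw [expand]
  exact neg_mem (homotopy_mem_barSpan
    (ι_letter_mul_mem_barSpan hq fun z hz => append_left_mem_lowerWords [x] hz))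

theorem homotopyDefect_wordBasis_mem_barSpan (hb : IsPBWBasis b) {l : List (NormalWord S)}
    (hl : ∀ v ∈ l, v.1 ≠ []) (hlen : l.length < (concat l).length) :
    homotopyDefect b (wordBasis b l) ∈ barSpan b l.length (lowerWords (concat l)) := by
  induction l with
  | nil => simp at hlen
  | cons u l ih =>
    obtain ⟨hu, hl'⟩ := List.forall_mem_cons.1 hl
    have hmem : wordBasis b l ∈ barSpan b l.length {concat l} := wordBasis_mem_barSpan hl' rfl
    rw [wordBasis_cons]
    rcases u with ⟨_ | ⟨x, _ | ⟨y, w⟩⟩, h⟩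
    · exact absurd rfl hu
    · replace hlen : l.length < (concat l).length := by simpa using hlen
      obtain ⟨y, w, hyw⟩ := List.exists_cons_of_length_pos (Nat.zero_lt_of_lt hlen)
      obtain ⟨n, hn⟩ : ∃ n, l.length = n + 1 := by
        rcases l with _ | ⟨v, l⟩
        exacts [by simp at hyw, ⟨_, rfl⟩]
      have ih := ih hl' hlen
      change _ ∈ barSpan b (l.length + 1) (lowerWords (x :: concat l))
      rw [hyw, hn] at hmem ih ⊢
      by_cases hxy : S x y
      · exact hb.homotopyDefect_letter_mem_barSpan_of_rel hxy hmem ih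
      · exact hb.homotopyDefect_letter_mem_barSpan_of_not_rel hxy hmem
    · exact hb.homotopyDefect_ι_mul_mem_barSpan h hmem

theorem exists_tensorBarD_eq_of_wordRank_lt [Finite X] (hb : IsPBWBasis b) {j : ℕ}
    (hj : n + 1 < j) (r : ℕ) (ht : t ∈ barSpan b (n + 1) {w | w.length = j ∧ wordRank w < r})
    (hd : tensorBarD t = 0) : ∃ s ∈ barSpan b (n + 2) {w | w.length = j}, tensorBarD s = t := by
  induction r generalizing t with
  | zero => exact ⟨0, zero_mem _, by simpa [barSpan, wordSpan, eq_comm] using ht⟩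
  | succ r ih =>
    have hdefect : homotopyDefect b t ∈ barSpan b (n + 1) {w | w.length = j ∧ wordRank w < r} := by
      refine map_mem_of_mem_wordSpan ?_ ht
      rintro l ⟨hn, hne, hlen, hr⟩
      rw [← hn]
      have hlower : lowerWords (concat l) ⊆ {w | w.length = j ∧ wordRank w < r} := fun w hw =>
        ⟨hw.1.trans hlen, (wordRank_lt_wordRank hw).trans_le (Nat.lt_succ_iff.1 hr)⟩
      exact barSpan_mono hlower (hb.homotopyDefect_wordBasis_mem_barSpan hne (by omega))
    have hdefect_eq : homotopyDefect b t = tensorBarD (homotopy b t) - t := by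
      rw [homotopyDefect_apply, hd, map_zero, add_zero]
    obtain ⟨s, hs, hs'⟩ := ih hdefect
      (by rw [hdefect_eq, map_sub, tensorBarD_tensorBarD, hd, sub_zero])
    refine ⟨homotopy b t - s, sub_mem (homotopy_mem_barSpan (barSpan_mono (fun w hw => hw.1) ht))
      hs, ?_⟩
    rw [map_sub, hs', hdefect_eq, sub_sub_cancel]

theorem exists_tensorBarD_eq [Finite X] (hb : IsPBWBasis b) {j : ℕ} (hj : n + 1 < j)
    (ht : t ∈ barSpan b (n + 1) {w | w.length = j}) (hd : tensorBarD t = 0) :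
    ∃ s ∈ barSpan b (n + 2) {w | w.length = j}, tensorBarD s = t := by
  obtain ⟨r, hr⟩ := ((List.finite_length_eq X j).image wordRank).bddAbove
  have hle : {w : List X | w.length = j} ⊆ {w | w.length = j ∧ wordRank w < r + 1} :=
    fun w hw => ⟨hw, Nat.lt_succ_of_le (hr ⟨w, hw, rfl⟩)⟩
  exact hb.exists_tensorBarD_eq_of_wordRank_lt hj (r + 1) (barSpan_mono hle ht) hd

end IsPBWBasis

/-! ### Koszulity -/

section LengthGrading

variable {X : Type*} {S : X → X → Prop} {k B : Type*} [CommRing k] [Ring B] [Algebra k B]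
  {b : Module.Basis (NormalWord S) k B}

/-- The grading of an algebra with a basis of normal words by the length of these words. -/
def lengthGrading (b : Module.Basis (NormalWord S) k B) (n : ℕ) : Submodule k B :=
  normalSpan b {w | w.length = n}

theorem basis_mem_lengthGrading (w : NormalWord S) : b w ∈ lengthGrading b w.1.length :=
  basis_mem_normalSpan rfl

theorem isInternal_lengthGrading [Nontrivial k] : DirectSum.IsInternal (lengthGrading b) := by
  rw [DirectSum.isInternal_submodule_iff_iSupIndep_and_iSup_eq_top]
  constructor
  · intro n
    have hle : ⨆ (m) (_ : m ≠ n), lengthGrading b m ≤ normalSpan b {w | w.length ≠ n} :=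
      iSup₂_le fun m hm => normalSpan_mono fun w (hw : w.length = m) => hw.trans_ne hm
    refine (b.linearIndependent.disjoint_span_image ?_).mono_right hle
    exact Set.disjoint_left.2 fun w (h : w.1.length = n) (h' : w.1.length ≠ n) => h' h
  · rw [eq_top_iff, ← b.span_eq, Submodule.span_le]
    rintro _ ⟨w, rfl⟩
    exact Submodule.mem_iSup_of_mem w.1.length (basis_mem_lengthGrading w)

theorem finite_lengthGrading [Finite X] (n : ℕ) : Module.Finite k (lengthGrading b n) :=
  Module.Finite.span_of_finite k
    (((List.finite_length_eq X n).preimage Subtype.val_injective.injOn).image b)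

namespace IsPBWBasis

variable [LinearOrder X]

theorem mul_mem_lengthGrading (hb : IsPBWBasis b) {i j : ℕ} {x y : B}
    (hx : x ∈ lengthGrading b i) (hy : y ∈ lengthGrading b j) :
    x * y ∈ lengthGrading b (i + j) := by
  suffices h : Submodule.map₂ (LinearMap.mul k B) (lengthGrading b i) (lengthGrading b j) ≤
      lengthGrading b (i + j) from h (Submodule.apply_mem_map₂ _ hx hy)
  rw [lengthGrading, lengthGrading, normalSpan, normalSpan, Submodule.map₂_span_span,
    Submodule.span_le]
  rintro _ ⟨_, ⟨u, rfl, rfl⟩, _, ⟨v, rfl, rfl⟩, rfl⟩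
  refine normalSpan_mono ?_ (hb.basis_mul_mem u v)
  intro w hw
  exact (length_of_mem_insert_lowerWords hw).trans List.length_append

theorem lengthGrading_zero (hb : IsPBWBasis b) : lengthGrading b 0 = Submodule.span k {1} := by
  rw [lengthGrading, normalSpan, ← hb.one, ← Set.image_singleton]
  congr 2
  ext w
  simp [Subtype.ext_iff]

theorem basis_mem_adjoin (hb : IsPBWBasis b) (w : NormalWord S) :
    b w ∈ Algebra.adjoin k (lengthGrading b 1 : Set B) := by
  obtain ⟨w, hw⟩ := w
  induction w with
  | nil => exact hb.one ▸ one_mem _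
  | cons x w ih =>
    have hw' : IsNormal S w := List.IsChain.tail hw
    have basis_cons : b (letter S x) * b ⟨w, hw'⟩ = b ⟨x :: w, hw⟩ :=
      hb.mul_of_isNormal (letter S x) ⟨w, hw'⟩ hw
    rw [← basis_cons]
    exact mul_mem (Algebra.subset_adjoin (basis_mem_lengthGrading (letter S x))) (ih hw')

theorem adjoin_lengthGrading_one (hb : IsPBWBasis b) :
    Algebra.adjoin k (lengthGrading b 1 : Set B) = ⊤ := by
  rw [← Algebra.toSubmodule_eq_top, eq_top_iff, ← b.span_eq, Submodule.span_le]
  exact Set.range_subset_iff.2 hb.basis_mem_adjoin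

end IsPBWBasis

end LengthGrading

section Koszul

variable {X : Type*} {S : X → X → Prop} {k B : Type*} [Field k] [Ring B] [Algebra k B]
  {b : Module.Basis (NormalWord S) k B} {n j : ℕ}

theorem bar_eq_bot {𝓑 : ℕ → Submodule k B} (h : j < n) : bar 𝓑 n j = ⊥ := by
  refine Submodule.span_eq_bot.2 ?_
  rintro _ ⟨d, a, hd, rfl, -⟩
  have le_sum : ∑ _i : Fin n, 1 ≤ ∑ i, d i := Finset.sum_le_sum fun i _ => hd i
  simp only [Finset.sum_const, Finset.card_univ, Fintype.card_fin, smul_eq_mul, mul_one] at le_sum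
  omega

theorem bar_zero_eq_bot {𝓑 : ℕ → Submodule k B} (h : j ≠ 0) : bar 𝓑 0 j = ⊥ := by
  refine Submodule.span_eq_bot.2 ?_
  rintro _ ⟨d, a, -, rfl, -⟩
  simp at h

theorem tprod_mem_barSpan {d : Fin n → ℕ} {a : Fin n → B} (hd : ∀ i, 0 < d i)
    (ha : ∀ i, a i ∈ lengthGrading b (d i)) :
    TensorAlgebra.tprod k B n a ∈ barSpan b n {w | w.length = ∑ i, d i} := by
  induction n with
  | zero =>
    have : TensorAlgebra.tprod k B 0 a = wordBasis b [] := by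
      simp [TensorAlgebra.tprod_apply, wordBasis_nil]
    rw [this]
    exact wordBasis_mem_barSpan (l := []) (by simp) (by simp)
  | succ n ih =>
    rw [tprod_succ, Fin.sum_univ_succ]
    refine ι_mul_mem_barSpan (P := {w | w.length = d 0}) (fun h => (hd 0).ne h) (ha 0)
      (ih (d := Fin.tail d) (a := Fin.tail a) (fun i => hd _) fun i => ha _) ?_
    intro u (hu : u.length = d 0) w hw
    exact List.length_append.trans (congrArg₂ _ hu hw)

theorem toTensorAlgebra_mem_barSpan {x : ⨂[k] _ : Fin n, B}
    (hx : x ∈ bar (lengthGrading b) n j) :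
    TensorPower.toTensorAlgebra x ∈ barSpan b n {w | w.length = j} := by
  suffices h : bar (lengthGrading b) n j ≤ (barSpan b n {w | w.length = j}).comap
      (TensorPower.toTensorAlgebra : (⨂[k] _ : Fin n, B) →ₗ[k] _) from h hx
  refine Submodule.span_le.2 ?_
  rintro _ ⟨d, a, hd, rfl, ha, rfl⟩
  rw [SetLike.mem_coe, Submodule.mem_comap, TensorPower.toTensorAlgebra_tprod]
  exact tprod_mem_barSpan hd ha

theorem exists_toTensorAlgebra_eq {t : TensorAlgebra k B}
    (ht : t ∈ barSpan b n {w | w.length = j}) :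
    ∃ x ∈ bar (lengthGrading b) n j, TensorPower.toTensorAlgebra x = t := by
  suffices h : barSpan b n {w | w.length = j} ≤ (bar (lengthGrading b) n j).map
      (TensorPower.toTensorAlgebra : (⨂[k] _ : Fin n, B) →ₗ[k] _) from h ht
  refine wordSpan_le.2 ?_
  rintro l ⟨rfl, hne, rfl⟩
  have sum_length : ∑ i, (l.get i).1.length = (concat l).length := by
    rw [← List.sum_ofFn, concat, List.length_flatten, List.map_map]
    exact congrArg List.sum ((List.ofFn_comp' l.get fun u : NormalWord S => u.1.length).trans
      (by rw [List.ofFn_get]; rfl))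
  have toTensorAlgebra_tprod : TensorPower.toTensorAlgebra
      (PiTensorProduct.tprod k fun i => b (l.get i)) = wordBasis b l := by
    refine (TensorPower.toTensorAlgebra_tprod _).trans ?_
    rw [TensorAlgebra.tprod_apply, wordBasis_eq_prod]
    exact congrArg List.prod ((List.ofFn_comp' l.get fun u : NormalWord S => ι k (b u)).trans
      (by rw [List.ofFn_get]))
  exact ⟨_, Submodule.subset_span ⟨_, _, fun i => List.length_pos_iff.2 (hne _ (l.get_mem i)),
    sum_length, fun i => basis_mem_lengthGrading _, rfl⟩, toTensorAlgebra_tprod⟩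

namespace IsPBWBasis

variable [LinearOrder X] [Finite X]

theorem barCycles_le_barBoundaries (hb : IsPBWBasis b) (h : j ≠ n) :
    barCycles (lengthGrading b) n j ≤ barBoundaries (lengthGrading b) n j := by
  cases n with
  | zero => simp [barCycles, bar_zero_eq_bot h]
  | succ n =>
    rcases lt_or_gt_of_ne h with h | h
    · simp [barCycles, bar_eq_bot h]
    · rintro x ⟨hx, hd : barD k B n x = 0⟩
      have hd' : tensorBarD (TensorPower.toTensorAlgebra x) = 0 := by
        rw [← toTensorAlgebra_barD, hd, map_zero]
      obtain ⟨s, hs, hsx⟩ := hb.exists_tensorBarD_eq h (toTensorAlgebra_mem_barSpan hx) hd'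
      obtain ⟨y, hy, rfl⟩ := exists_toTensorAlgebra_eq hs
      refine ⟨y, hy, toTensorAlgebra_injective (n + 1) ?_⟩
      rw [toTensorAlgebra_barD, hsx]

theorem isStandard (hb : IsPBWBasis b) : IsStandard (lengthGrading b) where
  one_mem := hb.one ▸ basis_mem_lengthGrading ⟨[], isNormal_nil⟩
  mul_mem _ _ _ _ := hb.mul_mem_lengthGrading
  isInternal := isInternal_lengthGrading
  finite := finite_lengthGrading
  nontrivial := ⟨b ⟨[], isNormal_nil⟩, 0, b.ne_zero _⟩
  connected := hb.lengthGrading_zero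
  generated := hb.adjoin_lengthGrading_one

theorem isKoszul (hb : IsPBWBasis b) : IsKoszul (lengthGrading b) where
  toIsStandard := hb.isStandard
  tor_concentrated n j h := by
    rw [Submodule.Quotient.subsingleton_iff, Submodule.submoduleOf_eq_top]
    exact hb.barCycles_le_barBoundaries h

end IsPBWBasis

end Koszul

/-! ### PBW presentations -/

section Reduction

variable {X k V B : Type*} [LinearOrder X] [CommRing k] [AddCommGroup V] [Module k V] [Ring B]
  [Algebra k B] {c : Module.Basis X k V} {S : X → X → Prop} {φ : TensorAlgebra k V →ₐ[k] B}

/-- Under `φ`, the pairs of letters in `S` become combinations of smaller pairs: they are the left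
hand sides of rewriting rules. -/
def ReducesPairs (c : Module.Basis X k V) (S : X → X → Prop) (φ : TensorAlgebra k V →ₐ[k] B) :
    Prop :=
  ∀ x y, S x y → φ (wordBasis c [x, y]) ∈ (wordSpan c (lowerWords [x, y])).map φ.toLinearMap

theorem ReducesPairs.map_wordBasis_mem (h : ReducesPairs c S φ) {w : List X}
    (hw : ¬ IsNormal S w) :
    φ (wordBasis c w) ∈ (wordSpan c (lowerWords w)).map φ.toLinearMap := by
  obtain ⟨x, y, p, s, rfl, hxy⟩ : ∃ x y p s, w = p ++ x :: y :: s ∧ S x y := by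
    simpa [IsNormal, List.isChain_iff_forall_rel_of_append_cons_cons] using hw
  obtain ⟨g, hg, hgφ⟩ := h x y hxy
  refine ⟨wordBasis c p * (g * wordBasis c s), ?_, ?_⟩
  · refine mul_mem_wordSpan (L := {p}) (L' := lowerWords ([x, y] ++ s)) ?_
      (wordBasis_mem_wordSpan rfl) (mul_mem_wordSpan (L' := {s}) ?_ hg (wordBasis_mem_wordSpan rfl))
    · rintro _ rfl u hu
      exact append_left_mem_lowerWords _ hu
    · rintro u hu _ rfl
      exact append_right_mem_lowerWords _ hu
  · have hw : wordBasis c (p ++ x :: y :: s) =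
        wordBasis c p * (wordBasis c [x, y] * wordBasis c s) := by
      rw [← wordBasis_append, ← wordBasis_append, List.cons_append, List.cons_append,
        List.nil_append]
    rw [AlgHom.toLinearMap_apply] at hgφ ⊢
    rw [hw, map_mul, map_mul, map_mul, map_mul, hgφ]

theorem ReducesPairs.map_wordSpan_inter_isNormal [Finite X] (h : ReducesPairs c S φ)
    {Q : Set (List X)} (hQ : ∀ w ∈ Q, lowerWords w ⊆ Q) :
    (wordSpan c (Q ∩ {w | IsNormal S w})).map φ.toLinearMap =
      (wordSpan c Q).map φ.toLinearMap := by
  refine le_antisymm (Submodule.map_mono (wordSpan_mono Set.inter_subset_left)) ?_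
  rw [Submodule.map_le_iff_le_comap, wordSpan_le]
  intro w hwQ
  induction w using (wordLT_wellFounded (X := X)).induction with | _ w ih
  rw [Submodule.mem_comap, AlgHom.toLinearMap_apply]
  by_cases hw : IsNormal S w
  · exact Submodule.mem_map_of_mem (wordBasis_mem_wordSpan ⟨hwQ, hw⟩)
  · refine Submodule.map_le_iff_le_comap.2 (wordSpan_le.2 fun u hu => ?_)
      (h.map_wordBasis_mem hw)
    exact ih u hu.2 (hQ w hwQ hu)

/-- The homomorphism `φ` presents `B` in such a way that the words which are normal with respect to
`S` form a basis of `B` and every other word is a combination of smaller ones. -/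
structure IsPBWPresentation (c : Module.Basis X k V) (S : X → X → Prop)
    (φ : TensorAlgebra k V →ₐ[k] B) : Prop where
  surjective : Function.Surjective φ
  reducesPairs : ReducesPairs c S φ
  linearIndependent : LinearIndependent k fun w : NormalWord S => φ (wordBasis c w.1)

namespace IsPBWPresentation

variable [Finite X]

theorem span_range (h : IsPBWPresentation c S φ) :
    Submodule.span k (Set.range fun w : NormalWord S => φ (wordBasis c w.1)) = ⊤ := by
  have span_normal := h.reducesPairs.map_wordSpan_inter_isNormal (Q := Set.univ)
    fun _ _ => Set.subset_univ _
  rw [wordSpan_univ, Submodule.map_top, LinearMap.range_eq_top.2 h.surjective, Set.univ_inter,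
    wordSpan, Submodule.map_span, Set.image_image, Set.image_eq_range] at span_normal
  exact span_normal

/-- The basis formed by the normal words. -/
def basis (h : IsPBWPresentation c S φ) : Module.Basis (NormalWord S) k B :=
  Module.Basis.mk h.linearIndependent h.span_range.ge

@[simp]
theorem basis_apply (h : IsPBWPresentation c S φ) (w : NormalWord S) :
    h.basis w = φ (wordBasis c w.1) := Module.Basis.mk_apply _ _ _

theorem map_wordSpan_eq_normalSpan (h : IsPBWPresentation c S φ) {Q : Set (List X)}
    (hQ : ∀ w ∈ Q, lowerWords w ⊆ Q) :
    (wordSpan c Q).map φ.toLinearMap = normalSpan h.basis Q := by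
  rw [← h.reducesPairs.map_wordSpan_inter_isNormal hQ, wordSpan, Submodule.map_span, normalSpan]
  congr 1
  ext x
  simp [and_assoc, and_left_comm]

theorem isPBWBasis (h : IsPBWPresentation c S φ) : IsPBWBasis h.basis where
  one := by rw [basis_apply, wordBasis_nil, map_one]
  mul_of_isNormal u v _ := by
    rw [basis_apply, basis_apply, basis_apply, ← map_mul, ← wordBasis_append]
  mul_of_not_isNormal u v huv := by
    rw [basis_apply, basis_apply, ← map_mul, ← wordBasis_append,
      ← h.map_wordSpan_eq_normalSpan fun _ => lowerWords_subset]
    exact h.reducesPairs.map_wordBasis_mem huv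

end IsPBWPresentation

end Reduction

theorem tensorGrading_eq_wordSpan {X k V : Type*} [Field k] [AddCommGroup V] [Module k V]
    (c : Module.Basis X k V) (m : ℕ) : tensorGrading k V m = wordSpan c {w | w.length = m} :=
  range_ι_pow_eq_wordSpan m

theorem IsPBWPresentation.isKoszul {X k V B : Type*} [LinearOrder X] [Finite X] [Field k]
    [AddCommGroup V] [Module k V] [Ring B] [Algebra k B] {c : Module.Basis X k V}
    {S : X → X → Prop} {φ : TensorAlgebra k V →ₐ[k] B} (h : IsPBWPresentation c S φ) :
    IsKoszul fun m => (tensorGrading k V m).map φ.toLinearMap := by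
  have map_eq : (fun m => (tensorGrading k V m).map φ.toLinearMap) = lengthGrading h.basis := by
    funext m
    rw [tensorGrading_eq_wordSpan c, lengthGrading, h.map_wordSpan_eq_normalSpan]
    exact fun w hw u hu => hu.1.trans hw
  exact map_eq ▸ h.isPBWBasis.isKoszul

/-! ### The associated graded algebra -/

section Filtration

variable {k A : Type*} [Field k] [Ring A] [Algebra k A] (W : Submodule k A) (m : ℕ)

theorem pow_le_filt : W ^ m ≤ filt W m := pow_le_pow_left' le_sup_right m

theorem filt_le_filtLT_sup_pow : filt W m ≤ filtLT W m ⊔ W ^ m := by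
  induction m with
  | zero => simp [filt]
  | succ m ih =>
    have filtLT_mul_le : filtLT W m * W ≤ filtLT W (m + 1) :=
      Submodule.mul_le.2 fun x hx y hy =>
        mul_mem_filtLT_left hx (pow_le_filt W 1 ((pow_one W).symm ▸ hy))
    have filt_mul_le : filt W m * W ≤ filtLT W (m + 1) ⊔ W ^ (m + 1) :=
      calc filt W m * W ≤ (filtLT W m ⊔ W ^ m) * W := mul_le_mul_left ih W
        _ = filtLT W m * W ⊔ W ^ (m + 1) := by rw [Submodule.sup_mul, pow_succ]
        _ ≤ filtLT W (m + 1) ⊔ W ^ (m + 1) := sup_le_sup_right filtLT_mul_le _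
    calc filt W (m + 1) = filt W m ⊔ filt W m * W := by
          rw [filt, pow_succ, Submodule.mul_sup, mul_one]
          rfl
      _ ≤ filtLT W (m + 1) ⊔ W ^ (m + 1) :=
        sup_le ((filt_le_filtLT m.lt_succ_self).trans le_sup_left) filt_mul_le

theorem filtLT_eq_iSup_pow : filtLT W m = ⨆ (i : ℕ) (_ : i < m), W ^ i := by
  induction m using Nat.strong_induction_on with
  | _ m ih =>
    refine le_antisymm (iSup₂_le fun i hi => ?_) (iSup₂_mono fun i _ => pow_le_filt W i)
    refine (filt_le_filtLT_sup_pow W i).trans (sup_le ?_ (le_iSup₂_of_le i hi le_rfl))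
    rw [ih i hi]
    exact iSup₂_le fun j hj => le_iSup₂_of_le j (hj.trans hi) le_rfl

end Filtration

section ToGr

variable {k V A : Type*} [Field k] [AddCommGroup V] [Module k V] [Ring A] [Algebra k A]
  {π : TensorAlgebra k V →ₐ[k] A} {m : ℕ} {f : TensorAlgebra k V}

theorem map_tensorGrading (m : ℕ) :
    (tensorGrading k V m).map π.toLinearMap = generators π ^ m := by
  rw [tensorGrading, Submodule.map_pow, ← LinearMap.range_comp, generators]

theorem map_mem_filt (hf : f ∈ tensorGrading k V m) : π f ∈ filt (generators π) m :=
  pow_le_filt _ m (map_tensorGrading (π := π) m ▸ Submodule.mem_map_of_mem hf)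

theorem map_ι_mem_filt (v : V) : π (ι k v) ∈ filt (generators π) 1 :=
  map_mem_filt (by rw [tensorGrading, pow_one]; exact ⟨v, rfl⟩)

variable (π) in
/-- The homomorphism from the tensor algebra to the associated graded algebra which maps a
generator to its symbol. -/
def toGr : TensorAlgebra k V →ₐ[k] Gr (generators π) :=
  TensorAlgebra.lift k (DirectSum.lof k ℕ (GrComp (generators π)) 1 ∘ₗ symb (generators π) 1 ∘ₗ
    (π.toLinearMap ∘ₗ ι k).codRestrict (filt (generators π) 1) map_ι_mem_filt)

theorem toGr_ι (v : V) : toGr π (ι k v) = DirectSum.of (GrComp (generators π)) 1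
    (symb (generators π) 1 ⟨π (ι k v), map_ι_mem_filt v⟩) :=
  TensorAlgebra.lift_ι_apply _ _

theorem toGr_of_mem_tensorGrading (hf : f ∈ tensorGrading k V m) : toGr π f =
    DirectSum.of (GrComp (generators π)) m (symb (generators π) m ⟨π f, map_mem_filt hf⟩) := by
  induction hf using Submodule.pow_induction_on_left' with
  | algebraMap r =>
    rw [AlgHom.commutes, DirectSum.algebraMap_apply]
    refine DirectSum.of_eq_of_gradedMonoid_eq
      (mk_symb_eq rfl (r • ⟨1, one_mem_filt⟩) _ ?_)
    simp [Algebra.algebraMap_eq_smul_one]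
  | add f g m hf hg ihf ihg =>
    rw [map_add, ihf, ihg, ← map_add, ← map_add]
    exact congrArg _ (congrArg _ (Subtype.ext (map_add π f g).symm))
  | mem_mul v hv m f hf ih =>
    obtain ⟨v, rfl⟩ := hv
    rw [map_mul, ih, toGr_ι, DirectSum.of_mul_of]
    refine DirectSum.of_eq_of_gradedMonoid_eq (mk_symb_eq (add_comm 1 m)
      ⟨_, mul_mem_filt (map_ι_mem_filt v) (map_mem_filt hf)⟩ _ ?_)
    exact (map_mul π _ _).symm

theorem toGr_eq_zero_iff (hf : f ∈ tensorGrading k V m) :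
    toGr π f = 0 ↔ π f ∈ filtLT (generators π) m := by
  rw [toGr_of_mem_tensorGrading hf, ← map_zero (DirectSum.of (GrComp (generators π)) m),
    (DirectSum.of_injective m).eq_iff, symb_eq_zero_iff]

theorem map_tensorGrading_toGr (m : ℕ) :
    (tensorGrading k V m).map (toGr π).toLinearMap = grGrading (generators π) m := by
  refine le_antisymm ?_ ?_
  · rintro _ ⟨f, hf, rfl⟩
    exact ⟨_, (toGr_of_mem_tensorGrading hf).symm⟩
  · rintro _ ⟨y, rfl⟩
    obtain ⟨⟨x, hx⟩, rfl⟩ := symb_surjective m y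
    obtain ⟨z, hz, _, hf, rfl⟩ := Submodule.mem_sup.1 (filt_le_filtLT_sup_pow _ m hx)
    rw [← map_tensorGrading] at hf
    obtain ⟨f, hf, rfl⟩ := hf
    refine ⟨f, hf, (toGr_of_mem_tensorGrading hf).trans (congrArg _ ?_)⟩
    rw [eq_comm, ← sub_eq_zero, ← map_sub, symb_eq_zero_iff]
    simpa using hz

theorem toGr_surjective : Function.Surjective (toGr π) := by
  intro y
  induction y using DirectSum.induction_on with
  | zero => exact ⟨0, map_zero _⟩
  | of m y =>
    obtain ⟨f, -, hf⟩ := (map_tensorGrading_toGr (π := π) m).ge ⟨y, rfl⟩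
    exact ⟨f, hf⟩
  | add y z hy hz =>
    obtain ⟨f, rfl⟩ := hy
    obtain ⟨g, rfl⟩ := hz
    exact ⟨f + g, map_add _ f g⟩

variable {X : Type*} {c : Module.Basis X k V}

theorem map_wordSpan_length_lt (m : ℕ) :
    (wordSpan c {w | w.length < m}).map π.toLinearMap = filtLT (generators π) m := by
  rw [filtLT_eq_iSup_pow]
  refine le_antisymm (Submodule.map_le_iff_le_comap.2 (wordSpan_le.2 fun w hw => ?_))
    (iSup₂_le fun i hi => ?_)
  · refine Submodule.mem_iSup_of_mem w.length (Submodule.mem_iSup_of_mem hw ?_)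
    rw [← map_tensorGrading, tensorGrading_eq_wordSpan c]
    exact Submodule.mem_map_of_mem (wordBasis_mem_wordSpan rfl)
  · rw [← map_tensorGrading, tensorGrading_eq_wordSpan c]
    exact Submodule.map_mono (wordSpan_mono fun w hw => hw.trans_lt hi)

theorem toGr_apply_of_mem_wordSpan (hf : f ∈ wordSpan c {w | w.length < m}) : toGr π f m = 0 := by
  refine map_mem_of_mem_wordSpan (P := ⊥)
    (f := DirectSum.component k ℕ (GrComp (generators π)) m ∘ₗ (toGr π).toLinearMap) ?_ hf
  intro w hw
  have hw' : wordBasis c w ∈ tensorGrading k V w.length :=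
    (tensorGrading_eq_wordSpan c w.length).ge (wordBasis_mem_wordSpan rfl)
  change toGr π (wordBasis c w) m = 0
  rw [toGr_of_mem_tensorGrading hw', DirectSum.of_eq_of_ne _ _ _ (Nat.ne_of_gt hw)]

theorem map_mem_filtLT_of_toGr_eq_zero (hf : f ∈ wordSpan c {w | w.length ≤ m})
    (h : toGr π f = 0) : π f ∈ filtLT (generators π) m := by
  have le_eq_union : {w : List X | w.length ≤ m} = {w | w.length = m} ∪ {w | w.length < m} := by
    ext w
    exact le_iff_eq_or_lt (α := ℕ)
  rw [le_eq_union, wordSpan_union] at hf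
  obtain ⟨p, hp, q, hq, rfl⟩ := Submodule.mem_sup.1 hf
  rw [← tensorGrading_eq_wordSpan] at hp
  have symb_eq_zero : symb (generators π) m ⟨π p, map_mem_filt hp⟩ = 0 := by
    have happ : toGr π (p + q) m = 0 := by rw [h]; rfl
    rwa [map_add, DirectSum.add_apply, toGr_apply_of_mem_wordSpan hq, add_zero,
      toGr_of_mem_tensorGrading hp, DirectSum.of_eq_same] at happ
  rw [map_add]
  exact add_mem ((symb_eq_zero_iff _).1 symb_eq_zero)
    (map_wordSpan_length_lt (π := π) (c := c) m ▸ Submodule.mem_map_of_mem hq)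

end ToGr

/-! ### The quadratic part of the relations -/

section QuadraticPart

variable {k V A : Type*} [Field k] [AddCommGroup V] [Module k V] [Ring A] [Algebra k A]
  {π : TensorAlgebra k V →ₐ[k] A} {R : Submodule k (TensorAlgebra k V)}

theorem sub_proj_mem_tensorGrading_one {f : TensorAlgebra k V}
    (hf : f ∈ tensorGrading k V 1 ⊔ tensorGrading k V 2) :
    f - GradedAlgebra.proj (tensorGrading k V) 2 f ∈ tensorGrading k V 1 := by
  obtain ⟨p, hp, q, hq, rfl⟩ := Submodule.mem_sup.1 hf
  rw [map_add, GradedAlgebra.proj_apply, GradedAlgebra.proj_apply,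
    DirectSum.decompose_of_mem_ne _ hp (by norm_num), DirectSum.decompose_of_mem_same _ hq,
    zero_add, add_sub_cancel_right]
  exact hp

theorem toGr_eq_zero_of_mem_quadraticPart (hA : IsAlmostQuadratic π R) {q : TensorAlgebra k V}
    (hq : q ∈ quadraticPart R) : toGr π q = 0 := by
  obtain ⟨f, hf, rfl⟩ := hq
  have map_f : π f = 0 := by
    rw [← TwoSidedIdeal.mem_ker, hA.ker_eq]
    exact TwoSidedIdeal.subset_span hf
  have hproj : GradedAlgebra.proj (tensorGrading k V) 2 f ∈ tensorGrading k V 2 :=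
    SetLike.coe_mem _
  refine (toGr_eq_zero_iff hproj).2 (filt_le_filtLT one_lt_two ?_)
  simpa [map_f] using
    neg_mem (map_mem_filt (π := π) (sub_proj_mem_tensorGrading_one (hA.le hf)))

theorem mk_eq_zero_of_mem_quadraticPart {q : TensorAlgebra k V} (hq : q ∈ quadraticPart R) :
    (quadraticCon R).mkₐ k q = 0 :=
  (RingCon.eq (quadraticCon R)).2
    ((TwoSidedIdeal.mem_iff _ _).1 (TwoSidedIdeal.subset_span hq))

/-- The homomorphism `A⁰ → gr A` induced by `toGr`. -/
def quadraticToGr (hA : IsAlmostQuadratic π R) : QuadraticAlg R →ₐ[k] Gr (generators π) :=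
  (quadraticCon R).liftₐ (toGr π) (by
    have h : TwoSidedIdeal.span (quadraticPart R : Set (TensorAlgebra k V)) ≤
        TwoSidedIdeal.ker (toGr π) := TwoSidedIdeal.span_le.2 fun q hq =>
      (TwoSidedIdeal.mem_ker _).2 (toGr_eq_zero_of_mem_quadraticPart hA hq)
    exact TwoSidedIdeal.ringCon_le_iff.1 h)

theorem quadraticToGr_mk (hA : IsAlmostQuadratic π R) (f : TensorAlgebra k V) :
    quadraticToGr hA ((quadraticCon R).mkₐ k f) = toGr π f := rfl

theorem map_quadraticGrading (hA : IsAlmostQuadratic π R) (m : ℕ) :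
    (quadraticGrading R m).map (quadraticToGr hA).toLinearMap = grGrading (generators π) m := by
  rw [quadraticGrading, ← Submodule.map_comp, ← map_tensorGrading_toGr]
  rfl

end QuadraticPart

/-! ### Gröbner bases -/

section LeadingWords

variable {k V : Type*} [Field k] [AddCommGroup V] [Module k V] {n : ℕ}
  {c : Module.Basis (Fin n) k V} {f g : TensorAlgebra k V} {w : FreeMonoid (Fin n)}

theorem isLeadingWord_iff :
    IsLeadingWord c f w ↔ (wordBasis c).repr f w.toList ≠ 0 ∧
      ∀ u, (wordBasis c).repr f u ≠ 0 → u ≠ w.toList → WordLT u w.toList := by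
  simp only [wordBasis, Module.Basis.repr_reindex_apply]
  rfl

theorem exists_isLeadingWord (hf : f ≠ 0) : ∃ w : FreeMonoid (Fin n), IsLeadingWord c f w := by
  obtain ⟨w, hw, h⟩ := exists_greatest_word ((wordBasis c).repr f).support (by simpa using hf)
  exact ⟨FreeMonoid.ofList w, isLeadingWord_iff.2
    ⟨by simpa using hw, fun u hu hne => h u (by simpa using hu) (by simpa using hne)⟩⟩

theorem IsLeadingWord.mem_wordSpan_length_le (hw : IsLeadingWord c f w) :
    f ∈ wordSpan c {u | u.length ≤ w.toList.length} := by
  refine mem_wordSpan_iff.2 fun u hu => ?_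
  rcases eq_or_ne u w.toList with rfl | hne
  · exact le_rfl (α := ℕ)
  · exact ((isLeadingWord_iff.1 hw).2 u hu hne).length_le

theorem IsLeadingWord.sub_of_length_lt (hw : IsLeadingWord c f w)
    (hg : g ∈ wordSpan c {u | u.length < w.toList.length}) : IsLeadingWord c (f - g) w := by
  have repr_sub {u : List (Fin n)} (hu : ¬ u.length < w.toList.length) :
      (wordBasis c).repr (f - g) u = (wordBasis c).repr f u := by
    rw [map_sub, Finsupp.sub_apply, not_imp_comm.1 (mem_wordSpan_iff.1 hg u) hu, sub_zero]
  rw [isLeadingWord_iff] at hw ⊢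
  refine ⟨repr_sub (lt_irrefl _) ▸ hw.1, fun u hu hne => ?_⟩
  by_cases hlen : u.length < w.toList.length
  · exact List.Shortlex.of_length_lt hlen
  · exact hw.2 u (repr_sub hlen ▸ hu) hne

theorem IsLeadingWord.wordBasis_sub_mem_wordSpan (hw : IsLeadingWord c f w)
    (hf : f ∈ tensorGrading k V w.toList.length) :
    wordBasis c w.toList - ((wordBasis c).repr f w.toList)⁻¹ • f ∈
      wordSpan c (lowerWords w.toList) := by
  rw [isLeadingWord_iff] at hw
  rw [tensorGrading_eq_wordSpan c, mem_wordSpan_iff] at hf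
  refine mem_wordSpan_iff.2 fun u hu => ?_
  rw [map_sub, map_smul, Module.Basis.repr_self, Finsupp.sub_apply, Finsupp.smul_apply,
    smul_eq_mul] at hu
  have hne : u ≠ w.toList := by
    intro hu_eq
    rw [hu_eq, Finsupp.single_eq_same, inv_mul_cancel₀ hw.1, sub_self] at hu
    exact hu rfl
  have hu : (wordBasis c).repr f u ≠ 0 := by
    rw [Finsupp.single_eq_of_ne hne, zero_sub, neg_ne_zero] at hu
    exact right_ne_zero_of_mul hu
  exact ⟨hf u hu, hw.2 u hu hne⟩

end LeadingWords

section Groebner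

variable {k V A B : Type*} [Field k] [AddCommGroup V] [Module k V] [Ring A] [Algebra k A]
  [Ring B] [Algebra k B] {n : ℕ} {c : Module.Basis (Fin n) k V} {π : TensorAlgebra k V →ₐ[k] A}
  {R : Submodule k (TensorAlgebra k V)} {G : Set (TensorAlgebra k V)} {f : TensorAlgebra k V}
  {w : FreeMonoid (Fin n)}

variable (c R) in
/-- The pairs of letters which are leading words of relations: the words which are normal with
respect to `LeadingPair c R` are the usual normal words of a quadratic Gröbner basis. -/
def LeadingPair (x y : Fin n) : Prop := ∃ f ∈ R, IsLeadingWord c f (FreeMonoid.ofList [x, y])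

theorem length_eq_two_of_isLeadingWord (hA : IsAlmostQuadratic π R) (hf : f ∈ R)
    (hw : IsLeadingWord c f w) : w.toList.length = 2 := by
  have length_eq : f ∈ wordSpan c ({u | u.length = 1} ∪ {u | u.length = 2}) := by
    rw [wordSpan_union, ← tensorGrading_eq_wordSpan, ← tensorGrading_eq_wordSpan]
    exact hA.le hf
  have hw_ne := (isLeadingWord_iff.1 hw).1
  refine (mem_wordSpan_iff.1 length_eq _ hw_ne).resolve_left fun hlen => ?_
  have hf_linear : f ∈ tensorGrading k V 1 := by
    rw [tensorGrading_eq_wordSpan c, mem_wordSpan_iff]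
    intro u hu
    have hle : u.length ≤ w.toList.length := mem_wordSpan_iff.1 hw.mem_wordSpan_length_le u hu
    have hpos : 0 < u.length := by
      rcases mem_wordSpan_iff.1 length_eq u hu with h | h <;> exact h ▸ Nat.succ_pos _
    exact le_antisymm (hle.trans_eq hlen) hpos
  have hf_zero : f = 0 := (Submodule.mem_bot k).1 (hA.inf_eq_bot ▸ ⟨hf, hf_linear⟩)
  simp [hf_zero] at hw_ne

theorem not_isNormal_of_isLeadingWord (hA : IsAlmostQuadratic π R) (hGR : G ⊆ R)
    {I : TwoSidedIdeal (TensorAlgebra k V)} (hG : IsGroebnerBasis c G I) (hf : f ∈ I)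
    (hw : IsLeadingWord c f w) : ¬ IsNormal (LeadingPair c R) w.toList := by
  obtain ⟨g, hg, u, hu, hinfix⟩ := hG.2 f hf w hw
  obtain ⟨x, y, hxy⟩ := List.length_eq_two.1 (length_eq_two_of_isLeadingWord hA (hGR hg) hu)
  intro hnormal
  have hpair : IsNormal (LeadingPair c R) [x, y] := hxy ▸ List.IsChain.infix hnormal hinfix
  exact (isNormal_cons_cons.1 hpair).1 ⟨g, hGR hg, hxy ▸ hu⟩

theorem reducesPairs_leadingPair (hR : R ≤ tensorGrading k V 1 ⊔ tensorGrading k V 2)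
    {φ : TensorAlgebra k V →ₐ[k] B} (hφ : ∀ q ∈ quadraticPart R, φ q = 0) :
    ReducesPairs c (LeadingPair c R) φ := by
  rintro x y ⟨f, hf, hlead⟩
  set q := GradedAlgebra.proj (tensorGrading k V) 2 f
  have hlead_q : IsLeadingWord c q (FreeMonoid.ofList [x, y]) := by
    rw [← sub_sub_cancel f q]
    refine hlead.sub_of_length_lt (wordSpan_mono ?_ (tensorGrading_eq_wordSpan c 1 ▸
      sub_proj_mem_tensorGrading_one (hR hf)))
    intro u hu
    exact hu.trans_lt one_lt_two
  have hq_mem : q ∈ tensorGrading k V 2 := SetLike.coe_mem _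
  refine ⟨_, hlead_q.wordBasis_sub_mem_wordSpan hq_mem, ?_⟩
  simp [hφ q ⟨f, hf, rfl⟩]

theorem eq_zero_of_toGr_eq_zero (hA : IsAlmostQuadratic π R) (hGR : G ⊆ R)
    (hG : IsGroebnerBasis c G (TwoSidedIdeal.span (R : Set (TensorAlgebra k V))))
    (hf : f ∈ wordSpan c {w | IsNormal (LeadingPair c R) w}) (hf_gr : toGr π f = 0) : f = 0 := by
  by_contra hne
  obtain ⟨w, hw⟩ := exists_isLeadingWord (c := c) hne
  -- Subtracting shorter words moves `f` into the ideal of relations without changing its leading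
  -- word, which is normal: this contradicts the Gröbner property.
  obtain ⟨g, hg, hgf⟩ : ∃ g ∈ wordSpan c {u | u.length < w.toList.length}, π g = π f := by
    have h := map_mem_filtLT_of_toGr_eq_zero hw.mem_wordSpan_length_le hf_gr
    rwa [← map_wordSpan_length_lt (c := c)] at h
  have sub_mem_ideal : f - g ∈ TwoSidedIdeal.span (R : Set (TensorAlgebra k V)) := by
    rw [← hA.ker_eq, TwoSidedIdeal.mem_ker, map_sub, hgf, sub_self]
  exact not_isNormal_of_isLeadingWord hA hGR hG sub_mem_ideal (hw.sub_of_length_lt hg)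
    (mem_wordSpan_iff.1 hf _ (isLeadingWord_iff.1 hw).1)

theorem isPBWPresentation_toGr (hA : IsAlmostQuadratic π R) (hGR : G ⊆ R)
    (hG : IsGroebnerBasis c G (TwoSidedIdeal.span (R : Set (TensorAlgebra k V)))) :
    IsPBWPresentation c (LeadingPair c R) (toGr π) where
  surjective := toGr_surjective
  reducesPairs := reducesPairs_leadingPair hA.le fun _ => toGr_eq_zero_of_mem_quadraticPart hA
  linearIndependent := by
    refine ((wordBasis c).linearIndependent.comp _ Subtype.val_injective).map
      (f := (toGr π).toLinearMap) (Submodule.disjoint_def.2 fun f hf hf_gr => ?_)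
    refine eq_zero_of_toGr_eq_zero hA hGR hG ?_ hf_gr
    refine Submodule.span_mono ?_ hf
    rintro _ ⟨w, rfl⟩
    exact ⟨w.1, w.2, rfl⟩

theorem isPBWPresentation_mk (hA : IsAlmostQuadratic π R)
    (h : IsPBWPresentation c (LeadingPair c R) (toGr π)) :
    IsPBWPresentation c (LeadingPair c R) ((quadraticCon R).mkₐ k) where
  surjective := RingCon.mkₐ_surjective (α := k) _
  reducesPairs := reducesPairs_leadingPair hA.le fun _ => mk_eq_zero_of_mem_quadraticPart
  linearIndependent := .of_comp (quadraticToGr hA).toLinearMap h.linearIndependent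

theorem quadraticToGr_bijective (hA : IsAlmostQuadratic π R)
    (h : IsPBWPresentation c (LeadingPair c R) (toGr π)) :
    Function.Bijective (quadraticToGr hA) := by
  refine ⟨LinearMap.injective_of_linearIndependent (f := (quadraticToGr hA).toLinearMap)
    (isPBWPresentation_mk hA h).span_range h.linearIndependent, fun y => ?_⟩
  obtain ⟨f, rfl⟩ := toGr_surjective y
  exact ⟨_, quadraticToGr_mk hA f⟩

end Groebner

end AlmostQuadratic

end

theorem mainTheorem3 {k V A : Type*} [Field k] [AddCommGroup V] [Module k V]
    [FiniteDimensional k V] [Ring A] [Algebra k A]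
    (π : TensorAlgebra k V →ₐ[k] A) (R : Submodule k (TensorAlgebra k V))
    (hA : AlmostQuadratic.IsAlmostQuadratic π R) (hPBW : AlmostQuadratic.IsPBW R) :
    AlmostQuadratic.IsPriddyKoszul π R := by
  open AlmostQuadratic in
  obtain ⟨n, c, m, r, hG⟩ := hPBW
  have hGR : Set.range (fun i => (r i : TensorAlgebra k V)) ⊆ R :=
    Set.range_subset_iff.2 fun i => (r i).2
  have hgr := isPBWPresentation_toGr hA hGR hG
  exact
    { iso := ⟨AlgEquiv.ofBijective _ (quadraticToGr_bijective hA hgr), map_quadraticGrading hA⟩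
      koszul_quadratic := (isPBWPresentation_mk hA hgr).isKoszul
      koszul_gr := funext (map_tensorGrading_toGr (π := π)) ▸ hgr.isKoszul }
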